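/- Consider the problem $\min_{x\in\mathbb R^d} f(x):=\mathbb E_{\xi\sim P}[\tilde f(x,\xi)]$ subject to $Ax=b$, where $A\in\mathbb R^{n\times d}$, $A\neq 0$, the system $Ax=b$ is consistent, and $\delta>0$ is the smallest nonzero eigenvalue of $A^\top A$. Let $f$ be differentiable with $f(x)\ge \underline f$ for all $x$, and let $\tilde\nabla f(x,\xi)$ be a (jointly measurable) stochastic gradient oracle such that, for all $u,v,x$ and constants $L_f>0$ and $V$, $$\mathbb E_\xi\tilde\nabla f(x,\xi)=\nabla f(x),\qquad \mathbb E_\xi\|\tilde\nabla f(u,\xi)-\tilde\nabla f(v,\xi)\|^2\le L_f^2\|u-v\|^2,\qquad \mathbb E_\xi\|\tilde\nabla f(x,\xi)-\nabla f(x)\|^2\le V^2 .$$ For arbitrary constants $c_1,c_2,c_3,c_4>0$ put $c=121L_f^2$ and $$m=\min\Big(\tfrac1{448L_f},\tfrac1{32(1+c_2+c_3)L_f},\tfrac1{8(1+2c_3)L_f}\Big),\quad \rho=\max\Big(\tfrac{7(1+c_1)}{m\delta},\tfrac{4(6+c_4)(1+c_1)L_f}{\delta},\tfrac{168(1+c_1)L_f}{\delta}\Big),\quad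 \eta=\tfrac1{11(L_f+\rho\|A\|^2)},$$ let $k_0$ be any real number with $$k_0\ge\max\Big(\big(\tfrac{10m}{3c_1\eta}\big)^2,\big(\tfrac{20}{3\eta c_2L_f}\big)^2,\tfrac{400}{3\eta^2c_4L_f^2},\big(\tfrac{20}{c\eta^2}\big)^4,\big(\tfrac{50}{3c\eta^2}\big)^6,2\Big),$$ and let $\eta_k=\dfrac{\eta}{(k+k_0)^{1/3}\log(k+k_0)}$, $\alpha_k=c\,\eta_k^2$. From arbitrary deterministic $x_0,\lambda_0,g_0$ and i.i.d. samples $\xi_1,\xi_2,\dots\sim P$, iterate for $k=0,1,\dots$ $$x_{k+1}=x_k-\eta_{k+1}\big(g_k+A^\top\lambda_k+\rho A^\top(Ax_k-b)\big),\qquad \lambda_{k+1}=\lambda_k+\rho(Ax_{k+1}-b),$$ $$g_{k+1}=\tilde\nabla f(x_{k+1},\xi_{k+1})+(1-\alpha_{k+1})\big(g_k-\tilde\nabla f(x_k,\xi_{k+1})\big).$$ Then there are constants $C>0$ and $q\in\mathbb N$, depending only on $L_f,V,\delta,\|A\|,c_1,\dots,c_4,k_0$ and on a common upper bound $R$ for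 $f(x_0)-\underline f$, $\|\lambda_0\|$, $\|g_0-\nabla f(x_0)\|$ and $\|Ax_0-b\|$, such that for every $\varepsilon\in(0,1]$ there is an integer $N\ge 1$ with $$N\le C\,\varepsilon^{-3}\big(1+\log\tfrac1\varepsilon\big)^q$$ and the following two properties. (i) The first $N+1$ iterations make at most $C\varepsilon^{-3}(1+\log\frac1\varepsilon)^q$ evaluations of stochastic gradients. (ii) For every $K\ge N$, if $\hat k$ is uniformly distributed on $\{1,\dots,K\}$ and independent of the samples, then the output $(\bar x,\bar\lambda)=(x_{\hat k},\lambda_{\hat k})$, and likewise the output $(\bar x,\bar\lambda)=(x_{\hat k+1},\lambda_{\hat k+1})$, satisfies $$\mathbb E\|\nabla f(\bar x)+A^\top\bar\lambda\|\le\varepsilon\qquad\text{and}\qquad \mathbb E\|A\bar x-b\|\le\varepsilon .$$ That is, an $\varepsilon$-stationary point in expectation is obtained within $\tilde O(\varepsilon^{-3})$ iterations and $\tilde O(\varepsilon^{-3})$ stochastic gradients. -/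

import Mathlib

open MeasureTheory ProbabilityTheory
open scoped ENNReal

noncomputable section

/-- The data of `min f(x) subject to A x = b`, `x ∈ ℝ^d`, `A` an `n × d` matrix (viewed as a linear
map between Euclidean spaces, so that `‖A‖` is the spectral norm), where `f(x) = E_{ξ ∼ P}[f̃(x, ξ)]`,
together with a stochastic gradient oracle `(x, ξ) ↦ oracle x ξ`. -/
structure LinConsProblem (Ξ : Type*) [MeasurableSpace Ξ] (d n : ℕ) where
  P : Measure Ξ
  fTilde : EuclideanSpace ℝ (Fin d) → Ξ → ℝ
  oracle : EuclideanSpace ℝ (Fin d) → Ξ → EuclideanSpace ℝ (Fin d)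
  A : EuclideanSpace ℝ (Fin d) →L[ℝ] EuclideanSpace ℝ (Fin n)
  b : EuclideanSpace ℝ (Fin n)

namespace LinConsProblem

variable {Ξ : Type*} [MeasurableSpace Ξ] {d n : ℕ}

/-- The objective `f(x) = E[f̃(x, ξ)]`. -/
def f (p : LinConsProblem Ξ d n) (x : EuclideanSpace ℝ (Fin d)) : ℝ :=
  ∫ ξ, p.fTilde x ξ ∂p.P

/-- The transpose `Aᵀ`. -/
def At (p : LinConsProblem Ξ d n) : EuclideanSpace ℝ (Fin n) →L[ℝ] EuclideanSpace ℝ (Fin d) :=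
  ContinuousLinearMap.adjoint p.A

/-- `δ` is the smallest nonzero eigenvalue of `AᵀA`. -/
def IsSmallestNonzeroEigenvalue (p : LinConsProblem Ξ d n) (δ : ℝ) : Prop :=
  IsLeast {t : ℝ | t ≠ 0 ∧
    Module.End.HasEigenvalue (p.At.toLinearMap ∘ₗ p.A.toLinearMap :
      Module.End ℝ (EuclideanSpace ℝ (Fin d))) t} δ

/-- Standing assumptions: `f` is well defined, differentiable and bounded below by `fLow`; the
oracle is unbiased, mean-square `Lf`-smooth and of variance at most `V ^ 2`; the constraint
`A x = b` is consistent. The second moments are `[0, ∞]`-valued integrals, so the bounds include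
finiteness. -/
structure Assumptions (p : LinConsProblem Ξ d n) (Lf V fLow : ℝ) : Prop where
  prob : IsProbabilityMeasure p.P
  integrable_fTilde : ∀ x, Integrable (p.fTilde x) p.P
  differentiable_f : Differentiable ℝ p.f
  measurable_oracle : Measurable (Function.uncurry p.oracle)
  unbiased : ∀ x, ∫ ξ, p.oracle x ξ ∂p.P = gradient p.f x
  meanSquareSmooth : ∀ u v,
    ∫⁻ ξ, ‖p.oracle u ξ - p.oracle v ξ‖ₑ ^ 2 ∂p.P ≤ ENNReal.ofReal (Lf ^ 2 * ‖u - v‖ ^ 2)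
  variance_le : ∀ x,
    ∫⁻ ξ, ‖p.oracle x ξ - gradient p.f x‖ₑ ^ 2 ∂p.P ≤ ENNReal.ofReal (V ^ 2)
  bounded_below : ∀ x, fLow ≤ p.f x
  feasible : ∃ x, p.A x = p.b

/-- State of the algorithm: primal iterate, dual iterate, gradient estimator, and the number of
stochastic gradient evaluations made so far. -/
structure State (d n : ℕ) where
  x : EuclideanSpace ℝ (Fin d)
  lam : EuclideanSpace ℝ (Fin n)
  g : EuclideanSpace ℝ (Fin d)
  calls : ℕ

/-- One oracle evaluation, which increases the counter by one. -/
def query (p : LinConsProblem Ξ d n) (x : EuclideanSpace ℝ (Fin d)) (ξ : Ξ) (calls : ℕ) :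
    EuclideanSpace ℝ (Fin d) × ℕ :=
  (p.oracle x ξ, calls + 1)

/-- One iteration of the linearized augmented Lagrangian method with the STORM estimator, with
penalty and dual step `ρ`, primal step `η`, momentum `α` and sample `ξ`. -/
def step (p : LinConsProblem Ξ d n) (ρ η α : ℝ) (ξ : Ξ) (s : State d n) : State d n :=
  let x' := s.x - η • (s.g + p.At s.lam + ρ • p.At (p.A s.x - p.b))
  let lam' := s.lam + ρ • (p.A x' - p.b)
  let q₁ := p.query x' ξ s.calls
  let q₂ := p.query s.x ξ q₁.2
  { x := x'
    lam := lam'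
    g := q₁.1 + (1 - α) • (s.g - q₂.1)
    calls := q₂.2 }

/-- The state after `k` iterations started from `(x₀, lam₀, g₀)`. Iteration `k` (from index `k` to
`k + 1`) uses `η (k + 1)`, `α (k + 1)` and a fresh sample, here called `ξ k`. -/
def run (p : LinConsProblem Ξ d n) (ρ : ℝ) (η α : ℕ → ℝ) (x₀ : EuclideanSpace ℝ (Fin d))
    (lam₀ : EuclideanSpace ℝ (Fin n)) (g₀ : EuclideanSpace ℝ (Fin d)) (ξ : ℕ → Ξ) :
    ℕ → State d n
  | 0 => { x := x₀, lam := lam₀, g := g₀, calls := 0 }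
  | k + 1 => p.step ρ (η (k + 1)) (α (k + 1)) (ξ k) (run p ρ η α x₀ lam₀ g₀ ξ k)

end LinConsProblem

/-! Parameter choices. -/

/-- The auxiliary weight `m`. -/
def weightM (c₂ c₃ Lf : ℝ) : ℝ :=
  min (1 / (448 * Lf)) (min (1 / (32 * (1 + c₂ + c₃) * Lf)) (1 / (8 * (1 + 2 * c₃) * Lf)))

/-- The penalty parameter and dual step size `ρ`. -/
def penaltyRho (c₁ c₂ c₃ c₄ Lf δ : ℝ) : ℝ :=
  max (7 * (1 + c₁) / (weightM c₂ c₃ Lf * δ))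
    (max (4 * (6 + c₄) * (1 + c₁) * Lf / δ) (168 * (1 + c₁) * Lf / δ))

/-- `η = 1 / (11 (Lf + ρ ‖A‖²))`. -/
def baseStep (Lf ρ normA : ℝ) : ℝ :=
  1 / (11 * (Lf + ρ * normA ^ 2))

/-- The lower bound imposed on the shift `k₀`; here `c = 121 Lf²`. -/
def shiftLowerBound (c₁ c₂ c₄ Lf m η : ℝ) : ℝ :=
  max ((10 * m / (3 * c₁ * η)) ^ 2) (max ((20 / (3 * η * c₂ * Lf)) ^ 2)
    (max (400 / (3 * η ^ 2 * c₄ * Lf ^ 2)) (max ((20 / (121 * Lf ^ 2 * η ^ 2)) ^ 4)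
      (max ((50 / (3 * (121 * Lf ^ 2) * η ^ 2)) ^ 6) 2))))

/-- `η_k = η / ((k + k₀)^{1/3} log (k + k₀))`. -/
def stepSize (η k₀ : ℝ) (k : ℕ) : ℝ :=
  η / (((k : ℝ) + k₀) ^ (1 / 3 : ℝ) * Real.log ((k : ℝ) + k₀))

/-- `α_k = 121 Lf² η_k²`. -/
def momentum (Lf η k₀ : ℝ) (k : ℕ) : ℝ :=
  121 * Lf ^ 2 * stepSize η k₀ k ^ 2

end

/-! Write r_k = A x_k - b, G_k = (x_k - x_{k-1})/η_k, e_k = g_k - ∇f(x_k), γ_k = g_k - g_{k-1}, and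
L for L_f.

A primal step lowers the augmented Lagrangian by about η‖G‖², up to an error η‖e‖², and the dual
step raises it again by ρ‖r‖². Since r lies in the range of A, δ‖r‖² ≤ ‖Aᵀr‖², and the difference of
two consecutive optimality conditions expresses ρAᵀr_{k+1} through γ_k, G_{k+1} - G_k and the last
two displacements (`residual_le`). The term ‖G_{k+1} - G_k‖² carries no factor η, so the descent
cannot pay for it. Testing the same difference against G_{k+1} yields an energy ρ/(2η)‖r‖² + ½‖G‖²
that drops by ½‖G_{k+1} - G_k‖² (`energy_le`). Adding 1/(100L) times this energy to the augmented
Lagrangian gives a pathwise decrease in which only ‖e‖² and ‖γ‖² remain to be controlled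
(`augLagrangian_energy_step_le`).

These two are handled in expectation. As x_{k+1} is determined before the sample of iteration k is
drawn, E‖e‖² contracts by (1-α)² up to L²η²E‖G‖² and α²V². With weight of order 1/(L²η) and α =
121L²η², the contraction yields a drop of 2ηE‖e‖² and leaves noise of order L²V²η³, which is
summable because of the logarithm in the step size (`expected_potential_step_le`,
`sum_stepSize_pow_three_le`).

The potential contains ⟪λ, r⟫ and has no evident lower bound. After a dual step, however, it exceeds
(‖λ_{k+1}‖² - ‖λ_k‖²)/(2ρ) in expectation, and a potential that dominates the increments of a
nonnegative sequence cannot stay below a negative constant (`sum_le_of_potential`).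

Hence the sum of ηE‖G‖² + ηE‖e‖² + ρE‖r‖² is bounded. It controls both stationarity measures, and K
η_{K+1} is of order K^{2/3}/log K, so K of order (ε⁻¹(1 + log ε⁻¹))³ suffices
(`le_sq_mul_stepSize`). -/

/-! ### One-step inequalities without probability. -/

section Deterministic

open scoped RealInnerProductSpace

variable {E F : Type*} [NormedAddCommGroup E] [InnerProductSpace ℝ E]
  [NormedAddCommGroup F] [InnerProductSpace ℝ F]

/-- The descent lemma for a function with Lipschitz gradient. -/
theorem le_add_inner_gradient_add_sq [CompleteSpace E] {f : E → ℝ} {L : ℝ}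
    (hf : Differentiable ℝ f)
    (hL : ∀ x y, ‖gradient f x - gradient f y‖ ≤ L * ‖x - y‖) (x v : E) :
    f (x + v) ≤ f x + ⟪gradient f x, v⟫ + L / 2 * ‖v‖ ^ 2 := by
  set φ : ℝ → ℝ := fun t => f (x + t • v) - t * ⟪gradient f x, v⟫ - L / 2 * ‖v‖ ^ 2 * t ^ 2 with hφ
  have hderiv : ∀ t, HasDerivAt φ
      (⟪gradient f (x + t • v), v⟫ - ⟪gradient f x, v⟫ - L / 2 * ‖v‖ ^ 2 * (2 * t)) t := by
    intro t
    have h1 : HasDerivAt (fun t : ℝ => x + t • v) v t := by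
      simpa using ((hasDerivAt_id t).smul_const v).const_add x
    have h2 : HasDerivAt (fun t : ℝ => f (x + t • v)) (⟪gradient f (x + t • v), v⟫) t := by
      have h3 := (hf (x + t • v)).hasFDerivAt.comp_hasDerivAt t h1
      rwa [← inner_gradient_left] at h3
    have h4 : HasDerivAt (fun t : ℝ => t * ⟪gradient f x, v⟫) ⟪gradient f x, v⟫ t := by
      simpa using (hasDerivAt_id t).mul_const ⟪gradient f x, v⟫
    have h5 : HasDerivAt (fun t : ℝ => L / 2 * ‖v‖ ^ 2 * t ^ 2) (L / 2 * ‖v‖ ^ 2 * (2 * t)) t := by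
      simpa using (hasDerivAt_pow 2 t).const_mul (L / 2 * ‖v‖ ^ 2)
    exact (h2.sub h4).sub h5
  have hanti : AntitoneOn φ (Set.Ici 0) := by
    refine antitoneOn_of_deriv_nonpos (convex_Ici 0)
      (fun t _ => (hderiv t).continuousAt.continuousWithinAt)
      (fun t _ => (hderiv t).differentiableAt.differentiableWithinAt) ?_
    intro t ht
    rw [interior_Ici] at ht
    have ht' : 0 < t := ht
    rw [(hderiv t).deriv, ← inner_sub_left]
    have h1 := real_inner_le_norm (gradient f (x + t • v) - gradient f x) v
    have h2 := hL (x + t • v) x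
    rw [add_sub_cancel_left, norm_smul, Real.norm_of_nonneg ht'.le] at h2
    nlinarith [norm_nonneg v]
  have h := hanti (Set.mem_Ici.2 le_rfl) (Set.mem_Ici.2 zero_le_one) zero_le_one
  simp only [hφ] at h
  norm_num at h
  rw [← inner_gradient_left] at h
  linarith

/-- A gradient step of length 1/L lowers f by at least ‖∇f‖²/(2L), and f cannot fall below l. This
bounds ∇f(x₀) by the initial gap, so that no separate bound on it is needed. -/
theorem sq_norm_gradient_le [CompleteSpace E] {f : E → ℝ} {L l : ℝ} (hL0 : 0 < L)
    (hf : Differentiable ℝ f)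
    (hL : ∀ x y, ‖gradient f x - gradient f y‖ ≤ L * ‖x - y‖) (hl : ∀ x, l ≤ f x) (x : E) :
    ‖gradient f x‖ ^ 2 ≤ 2 * L * (f x - l) := by
  have h := le_add_inner_gradient_add_sq hf hL x (-L⁻¹ • gradient f x)
  have h2 := hl (x + -L⁻¹ • gradient f x)
  rw [inner_smul_right, real_inner_self_eq_norm_sq, norm_smul, mul_pow] at h
  have h3 : ‖-L⁻¹‖ ^ 2 = L⁻¹ ^ 2 := by rw [norm_neg, Real.norm_eq_abs, sq_abs]
  rw [h3] at h
  have h4 : L * L⁻¹ = 1 := mul_inv_cancel₀ hL0.ne'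
  have h5 : L / 2 * (L⁻¹ ^ 2 * ‖gradient f x‖ ^ 2) = L⁻¹ / 2 * ‖gradient f x‖ ^ 2 := by
    linear_combination (L⁻¹ / 2 * ‖gradient f x‖ ^ 2) * h4
  have h6 : L⁻¹ * ‖gradient f x‖ ^ 2 ≤ 2 * (f x - l) := by linarith
  have h7 := mul_le_mul_of_nonneg_left h6 hL0.le
  rw [← mul_assoc, h4] at h7
  linarith

/-- Rayleigh quotient of an eigenvector. The upper bound later turns a lower bound on ρδ into one on
ρ‖A‖². -/
theorem eigenvalue_adjoint_comp_self_bounds [CompleteSpace E] [CompleteSpace F]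
    (A : E →L[ℝ] F) {δ : ℝ}
    (h : Module.End.HasEigenvalue ((ContinuousLinearMap.adjoint A).toLinearMap ∘ₗ A.toLinearMap :
      Module.End ℝ E) δ) : 0 ≤ δ ∧ δ ≤ ‖A‖ ^ 2 := by
  obtain ⟨v, hv⟩ := h.exists_hasEigenvector
  have h1 : ‖A v‖ ^ 2 = δ * ‖v‖ ^ 2 := by
    have h2 : ContinuousLinearMap.adjoint A (A v) = δ • v := hv.apply_eq_smul
    rw [← real_inner_self_eq_norm_sq, ← ContinuousLinearMap.adjoint_inner_left, h2,
      inner_smul_left, real_inner_self_eq_norm_sq]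
    rfl
  have h2 : 0 < ‖v‖ ^ 2 := by have := norm_pos_iff.2 hv.2; positivity
  have h3 : ‖A v‖ ^ 2 ≤ ‖A‖ ^ 2 * ‖v‖ ^ 2 := by
    rw [← mul_pow]; gcongr; exact A.le_opNorm v
  constructor
  · by_contra hc
    nlinarith [sq_nonneg ‖A v‖]
  · exact le_of_mul_le_mul_right (h1 ▸ h3) h2

/-- `‖Aᵀ y‖² ≥ δ ‖y‖²` on the range of `A`, where `δ` bounds the nonzero spectrum of `Aᵀ A`
from below. -/
theorem mul_sq_norm_le_sq_norm_adjoint [FiniteDimensional ℝ E] [CompleteSpace F]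
    (A : E →L[ℝ] F) {δ : ℝ}
    (h : ∀ t, t ≠ 0 → Module.End.HasEigenvalue
      ((@ContinuousLinearMap.adjoint ℝ _ _ _ _ _ _ _ (FiniteDimensional.complete ℝ E) _ A).toLinearMap
        ∘ₗ A.toLinearMap : Module.End ℝ E) t → δ ≤ t) (v : E) :
    δ * ‖A v‖ ^ 2 ≤
      ‖@ContinuousLinearMap.adjoint ℝ _ _ _ _ _ _ _ (FiniteDimensional.complete ℝ E) _ A (A v)‖ ^ 2 := by
  have := FiniteDimensional.complete ℝ E
  set T : E →ₗ[ℝ] E := (ContinuousLinearMap.adjoint A).toLinearMap ∘ₗ A.toLinearMap with hT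
  have hTa : ∀ x, T x = ContinuousLinearMap.adjoint A (A x) := fun _ => rfl
  have hsymm : T.IsSymmetric := by
    intro x y
    rw [hTa, hTa, ContinuousLinearMap.adjoint_inner_left, ContinuousLinearMap.adjoint_inner_right]
  set b := hsymm.eigenvectorBasis rfl
  set ev := hsymm.eigenvalues rfl
  have hco : ∀ i, ⟪b i, T v⟫ = ev i * ⟪b i, v⟫ := by
    intro i
    have := hsymm.eigenvectorBasis_apply_self_apply rfl v i
    rwa [OrthonormalBasis.repr_apply_apply, OrthonormalBasis.repr_apply_apply] at this
  have h1 : ‖A v‖ ^ 2 = ∑ i, ev i * ⟪b i, v⟫ ^ 2 := by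
    rw [← real_inner_self_eq_norm_sq, ← ContinuousLinearMap.adjoint_inner_left, ← hTa,
      ← b.sum_inner_mul_inner]
    refine Finset.sum_congr rfl fun i _ => ?_
    rw [real_inner_comm, hco]; ring
  have h2 : ‖T v‖ ^ 2 = ∑ i, (ev i * ⟪b i, v⟫) ^ 2 := by
    rw [← b.sum_sq_norm_inner_right]
    refine Finset.sum_congr rfl fun i _ => ?_
    rw [hco, Real.norm_eq_abs, sq_abs]
  rw [← hTa, h2, h1, Finset.mul_sum]
  refine Finset.sum_le_sum fun i _ => ?_
  -- Both sides are weighted sums of squared eigencoordinates of `v`, and a zero eigenvalue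
  -- contributes to neither; only nonzero ones have to be compared with δ.
  by_cases hz : ev i = 0
  · simp [hz]
  · have h3 := hsymm.hasEigenvalue_eigenvalues rfl i
    have h4 : δ ≤ ev i := h (ev i) hz h3
    have h5 : 0 ≤ ev i := (eigenvalue_adjoint_comp_self_bounds A h3).1
    have : δ * (ev i * ⟪b i, v⟫ ^ 2) ≤ ev i * (ev i * ⟪b i, v⟫ ^ 2) := by gcongr
    linarith [this, (by ring : (ev i * ⟪b i, v⟫) ^ 2 = ev i * (ev i * ⟪b i, v⟫ ^ 2))]

/-- Change of the augmented Lagrangian in one primal step followed by one dual step. -/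
theorem augLagrangian_step_le (A : E →L[ℝ] F) (At : F →L[ℝ] E)
    (hAt : ∀ y x, ⟪At y, x⟫ = ⟪y, A x⟫) {L ρ h fx fx' : ℝ} (hρ : 0 ≤ ρ)
    {v e G : E} {lam r r' : F}
    (hf : fx' ≤ fx + ⟪v, h • G⟫ + L / 2 * ‖h • G‖ ^ 2)
    (hG : G = -(v + e + At lam + ρ • At r)) (hr : r' = r + h • A G) :
    fx' + ⟪lam + ρ • r', r'⟫ + ρ / 2 * ‖r'‖ ^ 2 ≤ fx + ⟪lam, r⟫ + ρ / 2 * ‖r‖ ^ 2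
      - h * ⟪e, G⟫ - h * ‖G‖ ^ 2 + (L + ρ * ‖A‖ ^ 2) / 2 * h ^ 2 * ‖G‖ ^ 2 + ρ * ‖r'‖ ^ 2 := by
  -- Eliminating the true gradient produces inner products of `A G` with λ and r; they cancel
  -- against those from expanding ⟪λ, r'⟫ and ‖r'‖².
  have hv : ⟪v, G⟫ = -‖G‖ ^ 2 - ⟪e, G⟫ - ⟪lam, A G⟫ - ρ * ⟪r, A G⟫ := by
    have : v = -G - e - At lam - ρ • At r := by rw [hG]; abel
    rw [this, inner_sub_left, inner_sub_left, inner_sub_left, inner_neg_left, inner_smul_left,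
      hAt, hAt, real_inner_self_eq_norm_sq]
    simp
  have hnorm : ‖r'‖ ^ 2 = ‖r‖ ^ 2 + 2 * h * ⟪r, A G⟫ + h ^ 2 * ‖A G‖ ^ 2 := by
    rw [hr, norm_add_sq_real, inner_smul_right, norm_smul, mul_pow, Real.norm_eq_abs, sq_abs]; ring
  have hlam : ⟪lam + ρ • r', r'⟫ = ⟪lam, r⟫ + h * ⟪lam, A G⟫ + ρ * ‖r'‖ ^ 2 := by
    rw [inner_add_left, inner_smul_left, real_inner_self_eq_norm_sq]
    congr 1
    rw [hr, inner_add_right, inner_smul_right]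
  have hA : ‖A G‖ ^ 2 ≤ ‖A‖ ^ 2 * ‖G‖ ^ 2 := by
    rw [← mul_pow]; gcongr; exact A.le_opNorm G
  rw [inner_smul_right, norm_smul, mul_pow, Real.norm_eq_abs, sq_abs, hv] at hf
  rw [hlam]
  have h1 : ρ / 2 * h ^ 2 * ‖A G‖ ^ 2 ≤ ρ / 2 * h ^ 2 * (‖A‖ ^ 2 * ‖G‖ ^ 2) := by gcongr
  have h2 : ρ / 2 * ‖r'‖ ^ 2 = ρ / 2 * (‖r‖ ^ 2 + 2 * h * ⟪r, A G⟫ + h ^ 2 * ‖A G‖ ^ 2) := by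
    rw [hnorm]
  linarith

/-- The energy identity for the difference of two consecutive optimality conditions. -/
theorem energy_identity (A : E →L[ℝ] F) (At : F →L[ℝ] E)
    (hAt : ∀ y x, ⟪At y, x⟫ = ⟪y, A x⟫) {ρ h h' : ℝ} (hh' : 0 < h')
    {γ G G' : E} {r r' : F} (hr : r' = r + h' • A G')
    (hopt : ρ • At r' + γ + (G' - G) - ρ • At (A (h' • G' - h • G)) = 0) :
    ρ / (2 * h') * ‖r'‖ ^ 2 + 1 / 2 * ‖G'‖ ^ 2 = ρ / (2 * h') * ‖r‖ ^ 2 + 1 / 2 * ‖G‖ ^ 2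
      - 1 / 2 * ‖G' - G‖ ^ 2 - ⟪γ, G'⟫ - ρ * h' / 2 * ‖A G'‖ ^ 2
      + ρ * ⟪A (h' • G' - h • G), A G'⟫ := by
  -- Test the optimality difference against `G'`. As h'AG' = r' - r, both ⟪r', AG'⟫ and ⟪G' - G, G'⟫
  -- polarize into differences of squares.
  have h0 : ⟪ρ • At r' + γ + (G' - G) - ρ • At (A (h' • G' - h • G)), G'⟫ = 0 := by
    rw [hopt, inner_zero_left]
  rw [inner_sub_left, inner_add_left, inner_add_left, inner_smul_left, inner_smul_left, hAt, hAt,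
    inner_sub_left, real_inner_self_eq_norm_sq] at h0
  simp only [conj_trivial] at h0
  have hA : h' • A G' = r' - r := by rw [hr]; abel
  have h1 : ‖r‖ ^ 2 = ‖r'‖ ^ 2 - 2 * h' * ⟪r', A G'⟫ + h' ^ 2 * ‖A G'‖ ^ 2 := by
    have : r = r' - h' • A G' := by rw [hA]; abel
    rw [this, norm_sub_sq_real, inner_smul_right, norm_smul, mul_pow, Real.norm_eq_abs, sq_abs]
    ring
  have h2 : ‖G' - G‖ ^ 2 = ‖G'‖ ^ 2 - 2 * ⟪G, G'⟫ + ‖G‖ ^ 2 := by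
    rw [norm_sub_sq_real, real_inner_comm]
  rw [h2, h1]
  field_simp
  linear_combination h' * 2 * h0

/-- With varying steps, h'G' - hG = h'(G' - G) - (h - h')G. The first part is absorbed by the energy
drop, the second is small because consecutive steps differ by a term of third order in the step. -/
theorem energy_le (A : E →L[ℝ] F) (At : F →L[ℝ] E)
    (hAt : ∀ y x, ⟪At y, x⟫ = ⟪y, A x⟫) {ρ h h' : ℝ} (hρ : 0 ≤ ρ) (hh' : 0 < h') (hhh : h' ≤ h)
    {γ G G' : E} {r r' : F} (hr : r' = r + h' • A G')
    (hopt : ρ • At r' + γ + (G' - G) - ρ • At (A (h' • G' - h • G)) = 0) :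
    ρ / (2 * h') * ‖r'‖ ^ 2 + 1 / 2 * ‖G'‖ ^ 2 ≤ ρ / (2 * h') * ‖r‖ ^ 2 + 1 / 2 * ‖G‖ ^ 2
      - 1 / 2 * ‖G' - G‖ ^ 2 + ‖γ‖ * ‖G'‖
      + ρ * ‖A‖ ^ 2 * (h' * ‖G' - G‖ + (h - h') * ‖G‖) * ‖G'‖ := by
  rw [energy_identity A At hAt hh' hr hopt]
  have h1 : -⟪γ, G'⟫ ≤ ‖γ‖ * ‖G'‖ := by
    have := abs_real_inner_le_norm γ G'
    exact (neg_le_abs _).trans this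
  have h2 : ‖h' • G' - h • G‖ ≤ h' * ‖G' - G‖ + (h - h') * ‖G‖ := by
    have : h' • G' - h • G = h' • (G' - G) - (h - h') • G := by
      rw [smul_sub, sub_smul]; abel
    rw [this]
    refine (norm_sub_le _ _).trans ?_
    rw [norm_smul, norm_smul, Real.norm_of_nonneg hh'.le, Real.norm_of_nonneg (sub_nonneg.2 hhh)]
  have h3 : ⟪A (h' • G' - h • G), A G'⟫
      ≤ ‖A‖ ^ 2 * (h' * ‖G' - G‖ + (h - h') * ‖G‖) * ‖G'‖ := by
    calc ⟪A (h' • G' - h • G), A G'⟫ ≤ ‖A (h' • G' - h • G)‖ * ‖A G'‖ := real_inner_le_norm _ _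
      _ ≤ (‖A‖ * ‖h' • G' - h • G‖) * (‖A‖ * ‖G'‖) := by
        gcongr <;> exact A.le_opNorm _
      _ = ‖A‖ ^ 2 * ‖h' • G' - h • G‖ * ‖G'‖ := by ring
      _ ≤ _ := by gcongr
  have h4 := mul_le_mul_of_nonneg_left h3 hρ
  have h5 : 0 ≤ ρ * h' / 2 * ‖A G'‖ ^ 2 := by positivity
  linarith

/-- Solve the optimality difference for ρAᵀr' and use the spectral bound on the range of A. This is
what pays for the increase caused by the dual step. -/
theorem residual_le (A : E →L[ℝ] F) (At : F →L[ℝ] E) (hAtn : ‖At‖ ≤ ‖A‖) {δ ρ h h' : ℝ}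
    (hρ : 0 ≤ ρ)
    {γ G G' : E} {r' : F} (hδr : δ * ‖r'‖ ^ 2 ≤ ‖At r'‖ ^ 2)
    (hopt : ρ • At r' + γ + (G' - G) - ρ • At (A (h' • G' - h • G)) = 0) :
    ρ * δ * (ρ * ‖r'‖ ^ 2) ≤ 3 * (‖γ‖ ^ 2 + ‖G' - G‖ ^ 2
      + (ρ * ‖A‖ ^ 2) ^ 2 * (2 * (h' ^ 2 * ‖G'‖ ^ 2 + h ^ 2 * ‖G‖ ^ 2))) := by
  set w := ρ • At (A (h' • G' - h • G)) with hw
  have h1 : ρ • At r' = w - γ - (G' - G) := by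
    have : ρ • At r' = (ρ • At r' + γ + (G' - G) - w) + (w - γ - (G' - G)) := by abel
    rw [this, hopt, zero_add]
  have h2 : ρ ^ 2 * ‖At r'‖ ^ 2 ≤ (‖w‖ + ‖γ‖ + ‖G' - G‖) ^ 2 := by
    have : ρ ^ 2 * ‖At r'‖ ^ 2 = ‖ρ • At r'‖ ^ 2 := by
      rw [norm_smul, mul_pow, Real.norm_eq_abs, sq_abs]
    rw [this, h1]
    gcongr
    exact (norm_sub_le _ _).trans (by gcongr; exact norm_sub_le _ _)
  have h3 : ‖w‖ ≤ ρ * ‖A‖ ^ 2 * (‖h' • G'‖ + ‖h • G‖) := by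
    rw [hw, norm_smul, Real.norm_of_nonneg hρ, mul_assoc]
    gcongr
    calc ‖At (A (h' • G' - h • G))‖ ≤ ‖At‖ * ‖A (h' • G' - h • G)‖ := At.le_opNorm _
      _ ≤ ‖A‖ * (‖A‖ * ‖h' • G' - h • G‖) := by
        gcongr; exact A.le_opNorm _
      _ ≤ ‖A‖ * (‖A‖ * (‖h' • G'‖ + ‖h • G‖)) := by gcongr; exact norm_sub_le _ _
      _ = _ := by ring
  have h4 : ‖w‖ ^ 2 ≤ (ρ * ‖A‖ ^ 2) ^ 2 * (2 * (h' ^ 2 * ‖G'‖ ^ 2 + h ^ 2 * ‖G‖ ^ 2)) := by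
    have h5 : ‖h' • G'‖ ^ 2 = h' ^ 2 * ‖G'‖ ^ 2 := by
      rw [norm_smul, mul_pow, Real.norm_eq_abs, sq_abs]
    have h6 : ‖h • G‖ ^ 2 = h ^ 2 * ‖G‖ ^ 2 := by
      rw [norm_smul, mul_pow, Real.norm_eq_abs, sq_abs]
    rw [← h5, ← h6]
    calc ‖w‖ ^ 2 ≤ (ρ * ‖A‖ ^ 2 * (‖h' • G'‖ + ‖h • G‖)) ^ 2 := by gcongr
      _ = (ρ * ‖A‖ ^ 2) ^ 2 * (‖h' • G'‖ + ‖h • G‖) ^ 2 := by ring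
      _ ≤ _ := by gcongr; exact add_sq_le
  have h5 : (‖w‖ + ‖γ‖ + ‖G' - G‖) ^ 2 ≤ 3 * (‖γ‖ ^ 2 + ‖G' - G‖ ^ 2 + ‖w‖ ^ 2) := by
    nlinarith [sq_nonneg (‖w‖ - ‖γ‖), sq_nonneg (‖w‖ - ‖G' - G‖), sq_nonneg (‖γ‖ - ‖G' - G‖)]
  have h6 := mul_le_mul_of_nonneg_left hδr (sq_nonneg ρ)
  linarith

/-- Requirements on two consecutive step sizes. -/
structure StepPair (L M h h' : ℝ) : Prop where
  pos : 0 < h'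
  le : h' ≤ h
  le_mul : h ≤ 5 / 4 * h'
  mul_le : M * h ≤ 1 / 1000
  sq_mul_le : M ^ 2 * h ≤ L
  inv_sub_inv_le : h'⁻¹ - h⁻¹ ≤ 12 * L ^ 2 * h'

/-- Pathwise decrease of the augmented Lagrangian plus energy in one iteration. -/
theorem augLagrangian_energy_step_le (A : E →L[ℝ] F) (At : F →L[ℝ] E)
    (hAt : ∀ y x, ⟪At y, x⟫ = ⟪y, A x⟫) (hAtn : ‖At‖ ≤ ‖A‖) {L δ ρ h h' fx fx' : ℝ} (hL : 0 < L)
    (hρ : 0 ≤ ρ) (hρδ : 3000 * L ≤ ρ * δ) (hs : StepPair L (L + ρ * ‖A‖ ^ 2) h h')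
    {v e γ G G' : E} {lam r r' : F}
    (hf : fx' ≤ fx + ⟪v, h' • G'⟫ + L / 2 * ‖h' • G'‖ ^ 2)
    (hG : G' = -(v + e + At lam + ρ • At r)) (hr : r' = r + h' • A G')
    (hδr : δ * ‖r'‖ ^ 2 ≤ ‖At r'‖ ^ 2)
    (hopt : ρ • At r' + γ + (G' - G) - ρ • At (A (h' • G' - h • G)) = 0) :
    fx' + ⟪lam + ρ • r', r'⟫ + ρ / 2 * ‖r'‖ ^ 2
        + 1 / (100 * L) * (ρ / (2 * h') * ‖r'‖ ^ 2 + 1 / 2 * ‖G'‖ ^ 2) + ρ * ‖r'‖ ^ 2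
      ≤ fx + ⟪lam, r⟫ + ρ / 2 * ‖r‖ ^ 2
        + 1 / (100 * L) * (ρ / (2 * h) * ‖r‖ ^ 2 + 1 / 2 * ‖G‖ ^ 2) + ρ / 8 * ‖r‖ ^ 2
        + h' * ‖e‖ ^ 2 - 1 / 2 * h' * ‖G'‖ ^ 2 + 1 / 100 * h * ‖G‖ ^ 2
        + 3 * (1 / (100 * L)) ^ 2 / h * ‖γ‖ ^ 2 := by
  have hh' := hs.pos
  have hh : 0 < h := hh'.trans_le hs.le
  have b1 := augLagrangian_step_le A At hAt hρ hf hG hr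
  have b2 := energy_le A At hAt hρ hh' hs.le hr hopt
  have b3 := residual_le A At hAtn hρ hδr hopt
  set a := ρ * ‖A‖ ^ 2 with ha
  have ha0 : 0 ≤ a := by positivity
  -- Weight of the energy. The budget: of the available h'‖G'‖², at most half is spent by t1-t6; of
  -- (m/2)‖G' - G‖², t4 and t6 spend m/8 + m/5; of (3m²/h)‖γ‖², t3 takes 5/2 and t7 takes 1/2.
  set m := 1 / (100 * L) with hm
  have hm0 : 0 < m := by positivity
  have hmL : m * L = 1 / 100 := by rw [hm]; field_simp
  set N := ‖G' - G‖
  set g' := ‖G'‖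
  set g := ‖G‖
  set c := ‖γ‖
  have hg' : 0 ≤ g' := norm_nonneg _
  have hg : 0 ≤ g := norm_nonneg _
  have hN : 0 ≤ N := norm_nonneg _
  have hc : 0 ≤ c := norm_nonneg _
  have hLh : L * h ≤ 1 / 1000 := le_trans (by gcongr; linarith) hs.mul_le
  have hLh' : L * h' ≤ 1 / 1000 := le_trans (by gcongr; exact hs.le) hLh
  have ha2 : a ^ 2 * h ≤ L := le_trans (by gcongr; linarith) hs.sq_mul_le
  have ha2' : a ^ 2 * h' ≤ L := le_trans (by gcongr; exact hs.le) ha2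
  have t1 : -(h' * ⟪e, G'⟫) ≤ h' * ‖e‖ ^ 2 + h' * g' ^ 2 / 4 := by
    have : -⟪e, G'⟫ ≤ ‖e‖ * g' := (neg_le_abs _).trans (abs_real_inner_le_norm e G')
    have h2 : ‖e‖ * g' ≤ ‖e‖ ^ 2 + g' ^ 2 / 4 := by linarith only [sq_nonneg (‖e‖ - g' / 2)]
    have h3 := mul_le_mul_of_nonneg_left (this.trans h2) hh'.le
    linarith only [h3]
  have t2 : (L + a) / 2 * h' ^ 2 * g' ^ 2 ≤ 1 / 2000 * h' * g' ^ 2 := by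
    have h1 : (L + a) * h' ≤ 1 / 1000 := le_trans (by gcongr; exact hs.le) hs.mul_le
    have h2 := mul_le_mul_of_nonneg_right h1 (by positivity : 0 ≤ h' * g' ^ 2)
    linarith only [h2]
  -- The weight 1/h on ‖γ‖² is affordable: in expectation ‖γ‖² is of order L²h²‖G‖², up to terms
  -- carrying α². The constant 5/2 is 2 times the ratio bound 5/4.
  have t3 : m * (c * g') ≤ h' * g' ^ 2 / 8 + 5 / 2 * m ^ 2 / h * c ^ 2 := by
    have h1 : m * (c * g') ≤ h' * g' ^ 2 / 8 + 2 * m ^ 2 / h' * c ^ 2 := by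
      have : 0 ≤ (h' * g' - 4 * m * c) ^ 2 / (8 * h') := by positivity
      have h2 : (h' * g' - 4 * m * c) ^ 2 / (8 * h')
          = h' * g' ^ 2 / 8 + 2 * m ^ 2 / h' * c ^ 2 - m * (c * g') := by field_simp; ring
      linarith only [this, h2]
    have h2 : 2 * m ^ 2 / h' ≤ 5 / 2 * m ^ 2 / h := by
      rw [div_le_div_iff₀ hh' hh]
      linarith only [mul_le_mul_of_nonneg_left hs.le_mul (by positivity : 0 ≤ 2 * m ^ 2)]
    have h3 := mul_le_mul_of_nonneg_right h2 (sq_nonneg c)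
    linarith only [h1, h3]
  have t4 : m * (a * (h' * N) * g') ≤ m * N ^ 2 / 8 + 1 / 50 * h' * g' ^ 2 := by
    have h1 : a * (h' * N) * g' ≤ N ^ 2 / 8 + 2 * (a ^ 2 * h') * (h' * g' ^ 2) := by
      linarith only [sq_nonneg (N - 4 * a * h' * g')]
    have h2 : 2 * (a ^ 2 * h') * (h' * g' ^ 2) ≤ 2 * L * (h' * g' ^ 2) := by gcongr
    have h3 := mul_le_mul_of_nonneg_left (h1.trans (add_le_add_right h2 _)) hm0.le
    have h4 : m * (N ^ 2 / 8 + 2 * L * (h' * g' ^ 2))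
        = m * N ^ 2 / 8 + 2 * (m * L) * (h' * g' ^ 2) := by ring
    rw [h4, hmL] at h3
    linarith only [h3]
  have hsub : h - h' ≤ 12 * L ^ 2 * h' ^ 2 * h := by
    have h1 := mul_le_mul_of_nonneg_left hs.inv_sub_inv_le (by positivity : 0 ≤ h * h')
    have h2 : h * h' * (h'⁻¹ - h⁻¹) = h - h' := by field_simp
    linarith only [h1, h2]
  have t5 : m * (a * ((h - h') * g) * g') ≤ 1 / 1000 * (h * g ^ 2 + h' * g' ^ 2) := by
    have h1 : m * a * (h - h') ≤ 1 / 1000 * h' := by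
      calc m * a * (h - h') ≤ m * a * (12 * L ^ 2 * h' ^ 2 * h) := by gcongr
        _ = 12 * (m * L) * (L * h') * (a * h) * h' := by ring
        _ ≤ 12 * (1 / 100) * (1 / 1000) * (1 / 1000) * h' := by
          rw [hmL]
          have : a * h ≤ 1 / 1000 := le_trans (by gcongr; linarith) hs.mul_le
          gcongr
        _ ≤ _ := by linarith
    have h2 : g * g' ≤ g ^ 2 + g' ^ 2 := by linarith only [sq_nonneg (g - g'), sq_nonneg g, sq_nonneg g']
    calc m * (a * ((h - h') * g) * g') = m * a * (h - h') * (g * g') := by ring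
      _ ≤ 1 / 1000 * h' * (g ^ 2 + g' ^ 2) := by gcongr
      _ ≤ 1 / 1000 * (h * g ^ 2 + h' * g' ^ 2) := by
        have := mul_le_mul_of_nonneg_right hs.le (sq_nonneg g)
        linarith only [this]
  -- One copy of ρ‖r'‖² is the cost of the dual step, the other is the surplus kept on the left. The
  -- factor 2 is (m/15)·3000L, since mL = 1/100.
  have t6 : 2 * (ρ * ‖r'‖ ^ 2) ≤ m / 5 * c ^ 2 + m / 5 * N ^ 2
      + 1 / 250 * (h' * g' ^ 2 + h * g ^ 2) := by
    have h1 : a ^ 2 * (2 * (h' ^ 2 * g' ^ 2 + h ^ 2 * g ^ 2))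
        ≤ 2 * L * (h' * g' ^ 2 + h * g ^ 2) := by
      linarith only [mul_le_mul_of_nonneg_right ha2 (by positivity : 0 ≤ h * g ^ 2),
        mul_le_mul_of_nonneg_right ha2' (by positivity : 0 ≤ h' * g' ^ 2)]
    have h2 : 3000 * L * (ρ * ‖r'‖ ^ 2) ≤ ρ * δ * (ρ * ‖r'‖ ^ 2) := by gcongr
    have h3 : 3000 * L * (ρ * ‖r'‖ ^ 2)
        ≤ 3 * (c ^ 2 + N ^ 2 + 2 * L * (h' * g' ^ 2 + h * g ^ 2)) := by
      linarith only [h1, h2, b3]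
    have h4 := mul_le_mul_of_nonneg_left h3 (by positivity : 0 ≤ m / 15)
    have h5 : m / 15 * (3000 * L * (ρ * ‖r'‖ ^ 2)) = 200 * (m * L) * (ρ * ‖r'‖ ^ 2) := by ring
    have h6 : m / 15 * (3 * (c ^ 2 + N ^ 2 + 2 * L * (h' * g' ^ 2 + h * g ^ 2)))
        = m / 5 * c ^ 2 + m / 5 * N ^ 2 + 2 / 5 * (m * L) * (h' * g' ^ 2 + h * g ^ 2) := by ring
    rw [h5, h6, hmL] at h4
    linarith only [h4]
  have t7 : m / 5 * c ^ 2 ≤ 1 / 2 * m ^ 2 / h * c ^ 2 := by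
    have : m / 5 ≤ 1 / 2 * m ^ 2 / h := by
      rw [le_div_iff₀ hh]
      have h1 : h ≤ m / 10 := by
        rw [hm, div_div, le_div_iff₀ (by positivity)]; linarith
      linarith only [mul_le_mul_of_nonneg_left h1 hm0.le, sq_nonneg m]
    gcongr
  -- The energy weight ρ/(2h) grows as the step shrinks; the growth costs at most ρ/8 times the old
  -- squared residual.
  have t8 : m * (ρ / (2 * h') * ‖r‖ ^ 2) ≤ m * (ρ / (2 * h) * ‖r‖ ^ 2) + ρ / 8 * ‖r‖ ^ 2 := by
    have h1 : m * (h'⁻¹ - h⁻¹) ≤ 1 / 4 := by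
      calc m * (h'⁻¹ - h⁻¹) ≤ m * (12 * L ^ 2 * h') := by gcongr; exact hs.inv_sub_inv_le
        _ = 12 * (m * L) * (L * h') := by ring
        _ ≤ 12 * (1 / 100) * (1 / 1000) := by rw [hmL]; gcongr
        _ ≤ _ := by norm_num
    have h2 := mul_le_mul_of_nonneg_right h1 (by positivity : 0 ≤ ρ / 2 * ‖r‖ ^ 2)
    have h3 : m * (ρ / (2 * h') * ‖r‖ ^ 2) = m * h'⁻¹ * (ρ / 2 * ‖r‖ ^ 2) := by field_simp
    have h4 : m * (ρ / (2 * h) * ‖r‖ ^ 2) = m * h⁻¹ * (ρ / 2 * ‖r‖ ^ 2) := by field_simp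
    rw [h3, h4]
    linarith only [h2]
  have b2' := mul_le_mul_of_nonneg_left b2 hm0.le
  have hmN : 0 ≤ m * N ^ 2 := by positivity
  have hhg : 0 ≤ h * g ^ 2 := by positivity
  have hhg' : 0 ≤ h' * g' ^ 2 := by positivity
  have e1 : 3 * m ^ 2 / h * c ^ 2 = 5 / 2 * m ^ 2 / h * c ^ 2 + 1 / 2 * m ^ 2 / h * c ^ 2 := by ring
  linarith only [b1, b2', t1, t2, t3, t4, t5, t6, t7, t8, hmN, hhg, hhg', e1]

end Deterministic

/-! ### Telescoping potentials and step-size estimates. -/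

section Scalars

/-- A potential that decreases up to summable errors and dominates the increments of a nonnegative
sequence controls the total decrease. -/
theorem sum_le_of_potential {Φ q e s : ℕ → ℝ} {S : ℝ}
    (hstep : ∀ k, Φ (k + 1) ≤ Φ k - q k + e k) (hq : ∀ k, 0 ≤ q k)
    (he : ∀ T, ∑ k ∈ Finset.range T, e k ≤ S)
    (hs : ∀ k, 0 ≤ s k) (hlow : ∀ k, s (k + 1) - s k ≤ Φ (k + 1)) (T : ℕ) :
    ∑ k ∈ Finset.range T, q k ≤ Φ 0 + S := by
  -- If the decrease exceeded the budget by τ > 0, the potential would stay below -τ from time T on,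
  -- so `s` would lose τ at every step and become negative.
  by_contra! hc
  set τ := ∑ k ∈ Finset.range T, q k - (Φ 0 + S) with hτ
  have hτ0 : 0 < τ := by linarith
  have hΦ : ∀ j, Φ j ≤ Φ 0 - ∑ k ∈ Finset.range j, q k + ∑ k ∈ Finset.range j, e k := by
    intro j
    induction j with
    | zero => simp
    | succ j ih =>
      rw [Finset.sum_range_succ, Finset.sum_range_succ]
      linarith [hstep j]
  have hneg : ∀ j, T ≤ j → Φ j ≤ -τ := by
    intro j hj
    have h1 : ∑ k ∈ Finset.range T, q k ≤ ∑ k ∈ Finset.range j, q k :=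
      Finset.sum_le_sum_of_subset_of_nonneg (Finset.range_mono hj) fun k _ _ => hq k
    linarith [hΦ j, he j]
  have hdec : ∀ n : ℕ, s (T + n) ≤ s T - n * τ := by
    intro n
    induction n with
    | zero => simp
    | succ n ih =>
      have h1 := hlow (T + n)
      have h2 := hneg (T + n + 1) (by omega)
      push_cast
      rw [← add_assoc]
      linarith
  obtain ⟨n, hn⟩ := exists_nat_gt (s T / τ)
  rw [div_lt_iff₀ hτ0] at hn
  linarith [hdec n, hs (T + n)]

/-- Each factor grows by at most 1 + 1/t: the power because its exponent is below 1, the logarithm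
because log(1 + 1/t) ≤ 1/t and log t ≥ 1. -/
theorem rpow_third_mul_log_succ_le {t : ℝ} (ht : 3 ≤ t) :
    (t + 1) ^ (1 / 3 : ℝ) * Real.log (t + 1) ≤ (1 + 4 / t) * (t ^ (1 / 3 : ℝ) * Real.log t) := by
  have ht0 : 0 < t := by linarith
  have hlog : 1 ≤ Real.log t := by
    rw [Real.le_log_iff_exp_le ht0]
    linarith [Real.exp_one_lt_d9]
  have e1 : t + 1 = t * (1 + 1 / t) := by field_simp
  have hu : 0 < 1 / t := by positivity
  have hu1 : 1 / t ≤ 1 := by rw [div_le_one ht0]; linarith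
  have h1 : (t + 1) ^ (1 / 3 : ℝ) ≤ t ^ (1 / 3 : ℝ) * (1 + 1 / t) := by
    rw [e1, Real.mul_rpow ht0.le (by positivity)]
    gcongr
    refine Real.rpow_le_self_of_one_le (by linarith) (by norm_num)
  have h2 : Real.log (t + 1) ≤ Real.log t * (1 + 1 / t) := by
    rw [e1, Real.log_mul ht0.ne' (by positivity)]
    have := Real.log_le_sub_one_of_pos (by positivity : 0 < 1 + 1 / t)
    nlinarith
  calc (t + 1) ^ (1 / 3 : ℝ) * Real.log (t + 1)
      ≤ (t ^ (1 / 3 : ℝ) * (1 + 1 / t)) * (Real.log t * (1 + 1 / t)) := by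
        gcongr
        exact Real.log_nonneg (by linarith)
    _ = (1 + 1 / t) ^ 2 * (t ^ (1 / 3 : ℝ) * Real.log t) := by ring
    _ ≤ _ := by
      have : (1 + 1 / t) ^ 2 ≤ 1 + 4 / t := by
        have : 4 / t = 4 * (1 / t) := by ring
        rw [this]; nlinarith
      have h3 : 0 ≤ t ^ (1 / 3 : ℝ) * Real.log t := by positivity
      gcongr

/-- Growth of `t^{1/3} log t` beyond the shift. -/
theorem rpow_third_mul_log_bounds {t θ : ℝ} (hθ : 0 < θ) (hθ' : 30000 ≤ 1 / θ)
    (ht0 : 0 < t) (ht : (50 / (363 * θ ^ 2)) ^ 6 ≤ t) :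
    3 ≤ t ∧ 16 ≤ t ∧ 1000 ≤ t ^ (1 / 3 : ℝ) * Real.log t ∧
      1 ≤ 121 * θ * (t ^ (1 / 3 : ℝ) * Real.log t) ∧
      5 * (t ^ (1 / 3 : ℝ) * Real.log t) ^ 2 ≤ 12 * θ ^ 2 * t := by
  -- The 24th root makes every quantity polynomial: t^{1/3} = y⁸, the sixth root of t is y⁴, and log
  -- t ≤ 24y.
  set y := t ^ (1 / 24 : ℝ) with hy
  have hy0 : 0 < y := by positivity
  have hyt : y ^ 24 = t := by
    rw [hy, ← Real.rpow_natCast, ← Real.rpow_mul ht0.le]; norm_num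
  have hy8 : t ^ (1 / 3 : ℝ) = y ^ 8 := by
    rw [hy, ← Real.rpow_natCast, ← Real.rpow_mul ht0.le]; norm_num
  have h6 : 50 / (363 * θ ^ 2) ≤ y ^ 4 := by
    refine le_of_pow_le_pow_left₀ (n := 6) (by norm_num) (by positivity) ?_
    rw [← pow_mul, hyt]; exact ht
  have hθy : 50 ≤ 363 * θ ^ 2 * y ^ 4 := by
    rw [div_le_iff₀ (by positivity)] at h6; linarith
  have hθ1 : θ ≤ 1 / 30000 := by
    rw [le_div_iff₀ hθ] at hθ'; linarith
  have hy4 : 100000000 ≤ y ^ 4 := by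
    by_contra! hc
    have h1 : θ ^ 2 ≤ (1 / 30000) ^ 2 := by gcongr
    have h2 : 363 * θ ^ 2 * y ^ 4 ≤ 363 * (1 / 30000) ^ 2 * 100000000 := by gcongr
    norm_num at h2
    linarith
  have hy1 : 100 ≤ y := by
    by_contra! hc
    have : y ^ 4 < 100 ^ 4 := by gcongr
    norm_num at this
    linarith
  have ht16 : 16 ≤ t := by
    rw [← hyt]
    calc (16 : ℝ) ≤ 100 ^ 24 := by norm_num
      _ ≤ y ^ 24 := by gcongr
  have hlog : 1 ≤ Real.log t := by
    rw [Real.le_log_iff_exp_le ht0]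
    linarith [Real.exp_one_lt_d9]
  have hlog2 : Real.log t ≤ 24 * y := by
    have := Real.log_le_rpow_div ht0.le (by norm_num : (0 : ℝ) < 1 / 24)
    rw [← hy] at this
    linarith
  rw [hy8]
  have hφ : y ^ 8 ≤ y ^ 8 * Real.log t := le_mul_of_one_le_right (by positivity) hlog
  refine ⟨by linarith, ht16, ?_, ?_, ?_⟩
  · refine le_trans ?_ hφ
    calc (1000 : ℝ) ≤ 100 ^ 8 := by norm_num
      _ ≤ y ^ 8 := by gcongr
  · have h1 : 121 * θ ^ 2 * y ^ 4 ≤ 121 * θ * (y ^ 8 * Real.log t) := by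
      have h2 : θ ^ 2 ≤ θ := by nlinarith
      have h3 : y ^ 4 ≤ y ^ 8 * Real.log t :=
        le_trans (pow_le_pow_right₀ (by linarith) (by norm_num)) hφ
      gcongr
    linarith
  · have h1 : (Real.log t) ^ 2 ≤ (24 * y) ^ 2 := by gcongr
    have h2 : 1 ≤ 363 / 50 * θ ^ 2 * y ^ 4 := by linarith
    calc 5 * (y ^ 8 * Real.log t) ^ 2 = 5 * y ^ 16 * (Real.log t) ^ 2 := by ring
      _ ≤ 5 * y ^ 16 * (24 * y) ^ 2 := by gcongr
      _ = 2880 * y ^ 18 * 1 := by ring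
      _ ≤ 2880 * y ^ 18 * (363 / 50 * θ ^ 2 * y ^ 4) := by gcongr
      _ = (2880 * (363 / 50)) * θ ^ 2 * y ^ 22 := by ring
      _ ≤ (12 * y ^ 2) * θ ^ 2 * y ^ 22 :=
        mul_le_mul_of_nonneg_right
          (mul_le_mul_of_nonneg_right (by nlinarith) (by positivity)) (by positivity)
      _ = 12 * θ ^ 2 * y ^ 24 := by ring
      _ = 12 * θ ^ 2 * t := by rw [hyt]

/-- With φ(t) = t^{1/3} log t and h = η/φ, the requirements become growth conditions: Mh = 1/(11φ);
M²h ≤ L reads 1 ≤ 121Lηφ; and 1/h' - 1/h ≤ 4φ/(tη) is compared with 12L²η/φ', which by φ' ≤ 5φ/4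
follows from 5φ² ≤ 12(Lη)²t. -/
theorem stepSize_pair {L η k₀ : ℝ} (hL : 0 < L) (hη : 0 < η) (hθ : 30000 ≤ 1 / (L * η))
    (hk₀ : (50 / (363 * (L * η) ^ 2)) ^ 6 ≤ k₀) (hk₀' : 2 ≤ k₀) (k : ℕ) :
    StepPair L (1 / (11 * η)) (stepSize η k₀ k) (stepSize η k₀ (k + 1)) := by
  set t : ℝ := k + k₀ with ht
  have hkt : k₀ ≤ t := by rw [ht]; linarith [(Nat.cast_nonneg k : (0 : ℝ) ≤ k)]
  have hθ0 : 0 < L * η := by positivity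
  obtain ⟨h3, h16, hφ1000, hφθ, hφsq⟩ :=
    rpow_third_mul_log_bounds hθ0 hθ (by linarith) (hk₀.trans hkt)
  have hsucc := rpow_third_mul_log_succ_le h3
  set φ := t ^ (1 / 3 : ℝ) * Real.log t with hφ
  set φ' := (t + 1) ^ (1 / 3 : ℝ) * Real.log (t + 1) with hφ'
  have e1 : stepSize η k₀ k = η / φ := rfl
  have e2 : stepSize η k₀ (k + 1) = η / φ' := by
    have : ((k + 1 : ℕ) : ℝ) + k₀ = t + 1 := by rw [ht]; push_cast; ring
    rw [stepSize, this]
  have hφ0 : 0 < φ := by linarith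
  have hle : φ ≤ φ' := by
    have h1 : 0 ≤ Real.log t := Real.log_nonneg (by linarith)
    have h2 : Real.log t ≤ Real.log (t + 1) := Real.log_le_log (by linarith) (by linarith)
    have h3 : t ^ (1 / 3 : ℝ) ≤ (t + 1) ^ (1 / 3 : ℝ) :=
      Real.rpow_le_rpow (by linarith) (by linarith) (by norm_num)
    rw [hφ, hφ']; gcongr
  have ht4 : 4 / t ≤ 1 / 4 := by rw [div_le_iff₀ (by linarith)]; linarith
  have hle2 : φ' ≤ 5 / 4 * φ := by nlinarith
  have hφ'0 : 0 < φ' := by linarith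
  rw [e1, e2]
  refine ⟨by positivity, by gcongr, ?_, ?_, ?_, ?_⟩
  · rw [div_le_iff₀ hφ0]
    have : 5 / 4 * (η / φ') * φ = η * (5 / 4 * φ / φ') := by ring
    rw [this]
    have : 1 ≤ 5 / 4 * φ / φ' := by rw [le_div_iff₀ hφ'0]; linarith
    nlinarith
  · have : 1 / (11 * η) * (η / φ) = 1 / (11 * φ) := by field_simp
    rw [this]
    apply one_div_le_one_div_of_le <;> linarith
  · have : (1 / (11 * η)) ^ 2 * (η / φ) = 1 / (121 * η * φ) := by field_simp; norm_num
    rw [this, div_le_iff₀ (by positivity)]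
    linarith
  · rw [inv_div, inv_div, ← sub_div, div_le_iff₀ hη]
    have h1 : φ' - φ ≤ 4 / t * φ := by linarith
    refine h1.trans ?_
    have h2 : 12 * L ^ 2 * (η / φ') * η = 12 * (L * η) ^ 2 / φ' := by ring
    have ht0 : 0 < t := by linarith
    rw [h2, le_div_iff₀ hφ'0, div_mul_eq_mul_div, div_mul_eq_mul_div, div_le_iff₀ ht0]
    nlinarith

/-- The cube is η³/(s log³ s) with s = k + 1 + k₀, dominated by the decrement of η³/log, which
telescopes. Without the logarithm in the step size the cubes would form a harmonic series. -/
theorem sum_stepSize_pow_three_le {η k₀ : ℝ} (hη : 0 < η) (hk₀ : 3 ≤ k₀) (T : ℕ) :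
    ∑ k ∈ Finset.range T, stepSize η k₀ (k + 1) ^ 3 ≤ η ^ 3 := by
  have hlog : ∀ k : ℕ, 1 ≤ Real.log (k + k₀) := fun k => by
    have hk : (0 : ℝ) ≤ k := Nat.cast_nonneg k
    rw [Real.le_log_iff_exp_le (by linarith)]
    linarith [Real.exp_one_lt_d9]
  have hstep : ∀ k : ℕ, stepSize η k₀ (k + 1) ^ 3
      ≤ η ^ 3 * (1 / Real.log (k + k₀) - 1 / Real.log ((k + 1 : ℕ) + k₀)) := by
    intro k
    have hk : (0 : ℝ) ≤ k := Nat.cast_nonneg k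
    set t : ℝ := k + k₀ with ht
    have e : ((k + 1 : ℕ) : ℝ) + k₀ = t + 1 := by rw [ht]; push_cast; ring
    have ht0 : 0 < t := by linarith
    have l1 : 1 ≤ Real.log t := hlog k
    have l2 : 1 ≤ Real.log (t + 1) := e ▸ hlog (k + 1)
    have l12 : Real.log t ≤ Real.log (t + 1) := Real.log_le_log ht0 (by linarith)
    rw [stepSize, e, div_pow, mul_pow, ← Real.rpow_natCast ((t + 1) ^ (1 / 3 : ℝ)),
      ← Real.rpow_mul (by linarith)]
    norm_num
    rw [div_eq_mul_inv]
    gcongr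
    have h1 : 1 / (t + 1) ≤ Real.log (t + 1) - Real.log t := by
      rw [← Real.log_div (by linarith) ht0.ne']
      have := Real.one_sub_inv_le_log_of_pos (by positivity : 0 < (t + 1) / t)
      rw [inv_div] at this
      have e2 : 1 - t / (t + 1) = 1 / (t + 1) := by field_simp; ring
      linarith
    have h2 : (Real.log t)⁻¹ - (Real.log (t + 1))⁻¹
        = (Real.log (t + 1) - Real.log t) / (Real.log t * Real.log (t + 1)) := by
      have : Real.log t ≠ 0 := by linarith
      have : Real.log (t + 1) ≠ 0 := by linarith
      field_simp
    rw [h2, le_div_iff₀ (by positivity)]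
    refine le_trans ?_ h1
    rw [← div_eq_inv_mul, div_le_div_iff₀ (by positivity) (by linarith)]
    have : Real.log t * Real.log (t + 1) ≤ Real.log (t + 1) ^ 3 := by
      calc Real.log t * Real.log (t + 1) ≤ Real.log (t + 1) * Real.log (t + 1) := by gcongr
        _ = Real.log (t + 1) ^ 2 := by ring
        _ ≤ Real.log (t + 1) ^ 3 := pow_le_pow_right₀ l2 (by norm_num)
    nlinarith
  calc ∑ k ∈ Finset.range T, stepSize η k₀ (k + 1) ^ 3
      ≤ ∑ k ∈ Finset.range T,
          η ^ 3 * (1 / Real.log (k + k₀) - 1 / Real.log ((k + 1 : ℕ) + k₀)) :=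
        Finset.sum_le_sum fun k _ => hstep k
    _ = η ^ 3 * (1 / Real.log ((0 : ℕ) + k₀) - 1 / Real.log (T + k₀)) := by
      rw [← Finset.mul_sum, Finset.sum_range_sub' (fun k : ℕ => 1 / Real.log (k + k₀))]
    _ ≤ η ^ 3 * 1 := by
      gcongr
      have h1 : 1 / Real.log ((0 : ℕ) + k₀) ≤ 1 := by
        rw [div_le_one (by linarith [hlog 0])]; exact hlog 0
      have h2 : 0 ≤ 1 / Real.log (T + k₀) := by have := hlog T; positivity
      linarith
    _ = η ^ 3 := mul_one _

/-- Sample size sufficient for accuracy `ε`. -/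
theorem le_sq_mul_stepSize {S η k₀ : ℝ} (hS : 0 ≤ S) (hη : 0 < η) (hk₀ : 2 ≤ k₀) {ε : ℝ}
    (hε : 0 < ε) (hε1 : ε ≤ 1) {K : ℕ}
    (hK : ((max 1 (9 * (S * (k₀ + 2) ^ 2 / η))) * (ε⁻¹ * (1 + Real.log ε⁻¹))) ^ 3 ≤ K) :
    S ≤ ε ^ 2 * (K * stepSize η k₀ (K + 1)) := by
  set σ₀ := max 1 (9 * (S * (k₀ + 2) ^ 2 / η))
  set l := Real.log ε⁻¹ with hl
  set U := ε⁻¹ * (1 + l) with hU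
  have hinv : 1 ≤ ε⁻¹ := (one_le_inv₀ hε).2 hε1
  have hl0 : 0 ≤ l := Real.log_nonneg hinv
  have hU1 : 1 ≤ U := one_le_mul_of_one_le_of_one_le hinv (by linarith)
  have hσ1 : 1 ≤ σ₀ := le_max_left _ _
  have hσ2 : 9 * (S * (k₀ + 2) ^ 2 / η) ≤ σ₀ := le_max_right _ _
  have hK1 : (1 : ℝ) ≤ K := le_trans (one_le_pow₀ (one_le_mul_of_one_le_of_one_le hσ1 hU1)) hK
  set y := (K : ℝ) ^ (1 / 3 : ℝ) with hy
  have hy0 : 0 < y := by positivity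
  have hy3 : y ^ 3 = K := by
    rw [hy, ← Real.rpow_natCast, ← Real.rpow_mul (by positivity)]; norm_num
  have hyU : σ₀ * U ≤ y := by
    refine le_of_pow_le_pow_left₀ (n := 3) (by norm_num) hy0.le ?_
    rw [hy3]; exact hK
  -- Writing K^{1/3} = σU with σ ≥ σ₀, the logarithm in the step size is at most a multiple of σ(1 +
  -- l). One factor σ absorbs the constants through σ₀, and (1 + l)σ = εy converts the rest into
  -- ε²K.
  set σ := y / U with hσ
  have hyσ : y = σ * U := by rw [hσ]; field_simp
  have hσσ : σ₀ ≤ σ := by rw [hσ, le_div_iff₀ (by linarith)]; exact hyU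
  have hσ0 : 0 < σ := by linarith
  have hlogy : 1 + 3 * Real.log y ≤ 9 * σ * (1 + l) := by
    rw [hyσ, hU, Real.log_mul hσ0.ne' (by positivity), Real.log_mul (by positivity) (by positivity),
      ← hl]
    have h1 := Real.log_le_sub_one_of_pos hσ0
    have h2 := Real.log_le_sub_one_of_pos (by positivity : 0 < 1 + l)
    nlinarith [mul_nonneg (by linarith : 0 ≤ σ - 1) hl0]
  have hlogK : Real.log K = 3 * Real.log y := by
    rw [← hy3, Real.log_pow]; norm_num
  set κ := k₀ + 2 with hκ
  set t : ℝ := ((K + 1 : ℕ) : ℝ) + k₀ with ht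
  have htκ : t ≤ κ * K := by rw [ht, hκ]; push_cast; nlinarith
  have ht3 : 3 ≤ t := by rw [ht]; push_cast; linarith
  have hr : t ^ (1 / 3 : ℝ) ≤ κ * y := by
    calc t ^ (1 / 3 : ℝ) ≤ (κ * K) ^ (1 / 3 : ℝ) :=
          Real.rpow_le_rpow (by linarith) htκ (by norm_num)
      _ = κ ^ (1 / 3 : ℝ) * y := Real.mul_rpow (by linarith) (by linarith)
      _ ≤ κ * y := by
        gcongr
        exact Real.rpow_le_self_of_one_le (by linarith) (by norm_num)
  have hlogt0 : 0 < Real.log t := Real.log_pos (by linarith)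
  have hlogt : Real.log t ≤ κ * (1 + 3 * Real.log y) := by
    have h1 : Real.log t ≤ Real.log κ + Real.log K := by
      rw [← Real.log_mul (by linarith) (by linarith)]
      exact Real.log_le_log (by linarith) htκ
    have h2 := Real.log_le_sub_one_of_pos (by linarith : 0 < κ)
    have h3 : 0 ≤ Real.log K := Real.log_nonneg hK1
    nlinarith
  have hden : 0 < t ^ (1 / 3 : ℝ) * Real.log t := by positivity
  rw [stepSize, mul_div_assoc', mul_div_assoc', le_div_iff₀ hden]
  have hS2 : S * κ ^ 2 = S * κ ^ 2 / η * η := by field_simp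
  calc S * (t ^ (1 / 3 : ℝ) * Real.log t)
      ≤ S * ((κ * y) * (κ * (1 + 3 * Real.log y))) := by gcongr
    _ ≤ S * ((κ * y) * (κ * (9 * σ * (1 + l)))) := by
      have : 0 ≤ κ := by linarith
      gcongr
    _ = (9 * (S * κ ^ 2 / η)) * (η * y * σ * (1 + l)) := by
      field_simp
    _ ≤ σ * (η * y * σ * (1 + l)) := by
      have : 0 ≤ 1 + l := by linarith
      gcongr
      linarith
    _ ≤ σ * (η * y * σ * (1 + l)) * (1 + l) := by
      apply le_mul_of_one_le_right
      · have : 0 ≤ 1 + l := by linarith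
        positivity
      · linarith
    _ = ε ^ 2 * (y ^ 3 * η) := by
      have : ε * U = 1 + l := by rw [hU]; field_simp
      have h2 : (1 + l) * σ = ε * y := by rw [← this, hyσ]; ring
      linear_combination η * y * ((1 + l) * σ + ε * y) * h2
    _ = ε ^ 2 * (K * η) := by rw [hy3]

end Scalars

/-! ### Second moments, independence and centered sums. -/

section SecondMoments

open scoped RealInnerProductSpace

variable {Ω Ξ T E : Type*} [MeasurableSpace Ω] [MeasurableSpace Ξ] [MeasurableSpace T]
  [NormedAddCommGroup E]

theorem memLp_two_of_lintegral_sq_le {μ : Measure Ω} {Y : Ω → E}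
    (hY : AEStronglyMeasurable Y μ) {c : ℝ}
    (h : ∫⁻ ω, ‖Y ω‖ₑ ^ 2 ∂μ ≤ ENNReal.ofReal c) : MemLp Y 2 μ := by
  refine ⟨hY, ?_⟩
  rw [eLpNorm_lt_top_iff_lintegral_rpow_enorm_lt_top (by norm_num) (by norm_num)]
  simpa using h.trans_lt ENNReal.ofReal_lt_top

theorem integral_sq_norm_le_of_lintegral_sq_le {μ : Measure Ω} {Y : Ω → E}
    (hY : AEStronglyMeasurable Y μ) {c : ℝ} (hc : 0 ≤ c)
    (h : ∫⁻ ω, ‖Y ω‖ₑ ^ 2 ∂μ ≤ ENNReal.ofReal c) : ∫ ω, ‖Y ω‖ ^ 2 ∂μ ≤ c := by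
  have hm : AEStronglyMeasurable (fun ω => ‖Y ω‖ ^ 2) μ := hY.norm.pow 2
  rw [integral_eq_lintegral_of_nonneg_ae (Filter.Eventually.of_forall fun _ => by positivity) hm]
  refine ENNReal.toReal_le_of_le_ofReal hc (le_trans (le_of_eq ?_) h)
  refine lintegral_congr fun ω => ?_
  rw [ENNReal.ofReal_pow (norm_nonneg _), ofReal_norm]

theorem lintegral_sq_enorm_eq {μ : Measure Ω} {Y : Ω → E} (hY : MemLp Y 2 μ) :
    ∫⁻ ω, ‖Y ω‖ₑ ^ 2 ∂μ = ENNReal.ofReal (∫ ω, ‖Y ω‖ ^ 2 ∂μ) := by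
  rw [ofReal_integral_eq_lintegral_ofReal ((memLp_two_iff_integrable_sq_norm hY.1).1 hY)
    (Filter.Eventually.of_forall fun _ => by positivity)]
  refine lintegral_congr fun ω => ?_
  rw [ENNReal.ofReal_pow (norm_nonneg _), ofReal_norm]

/-- A second-moment bound that holds for each frozen first argument holds after inserting an
independent random first argument. -/
theorem sq_moment_le_of_indepFun [MeasurableSpace E] [BorelSpace E]
    [SecondCountableTopology E] {μ : Measure Ω} [IsProbabilityMeasure μ] {P : Measure Ξ}
    {S : Ω → T} {X : Ω → Ξ} (hS : Measurable S) (hX : Measurable X) (hind : IndepFun S X μ)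
    (hP : μ.map X = P) {H : T × Ξ → E} (hH : Measurable H) {B : T → ℝ} (hB : ∀ s, 0 ≤ B s)
    (hBi : Integrable (fun ω => B (S ω)) μ)
    (hb : ∀ s, ∫⁻ ξ, ‖H (s, ξ)‖ₑ ^ 2 ∂P ≤ ENNReal.ofReal (B s)) :
    MemLp (fun ω => H (S ω, X ω)) 2 μ ∧
      ∫ ω, ‖H (S ω, X ω)‖ ^ 2 ∂μ ≤ ∫ ω, B (S ω) ∂μ := by
  have hHm : Measurable fun z : T × Ξ => ‖H z‖ₑ ^ 2 := hH.enorm.pow_const 2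
  have : IsProbabilityMeasure P := hP ▸ Measure.isProbabilityMeasure_map hX.aemeasurable
  have key : ∫⁻ ω, ‖H (S ω, X ω)‖ₑ ^ 2 ∂μ ≤ ENNReal.ofReal (∫ ω, B (S ω) ∂μ) := by
    have h1 := (indepFun_iff_map_prod_eq_prod_map_map hS.aemeasurable hX.aemeasurable).1 hind
    calc ∫⁻ ω, ‖H (S ω, X ω)‖ₑ ^ 2 ∂μ
        = ∫⁻ z, ‖H z‖ₑ ^ 2 ∂(μ.map fun ω => (S ω, X ω)) :=
          (lintegral_map hHm (hS.prodMk hX)).symm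
      _ = ∫⁻ s, ∫⁻ ξ, ‖H (s, ξ)‖ₑ ^ 2 ∂P ∂(μ.map S) := by
        rw [h1, hP, lintegral_prod _ hHm.aemeasurable]
      _ = ∫⁻ ω, ∫⁻ ξ, ‖H (S ω, ξ)‖ₑ ^ 2 ∂P ∂μ := lintegral_map hHm.lintegral_prod_right' hS
      _ ≤ ∫⁻ ω, ENNReal.ofReal (B (S ω)) ∂μ := lintegral_mono fun ω => hb _
      _ = _ := (ofReal_integral_eq_lintegral_ofReal hBi
        (Filter.Eventually.of_forall fun _ => hB _)).symm
  have hm : AEStronglyMeasurable (fun ω => H (S ω, X ω)) μ :=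
    (hH.comp (hS.prodMk hX)).aestronglyMeasurable
  exact ⟨memLp_two_of_lintegral_sq_le hm key,
    integral_sq_norm_le_of_lintegral_sq_le hm (integral_nonneg fun _ => hB _) key⟩

/-- Jensen's inequality, read off from the nonnegativity of the variance of the norm. -/
theorem sq_integral_norm_le {μ : Measure Ω} [IsProbabilityMeasure μ] {Y : Ω → E}
    (hY : MemLp Y 2 μ) : (∫ ω, ‖Y ω‖ ∂μ) ^ 2 ≤ ∫ ω, ‖Y ω‖ ^ 2 ∂μ := by
  have hi : Integrable (fun ω => ‖Y ω‖) μ := (hY.integrable (by norm_num)).norm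
  have hi2 := (memLp_two_iff_integrable_sq_norm hY.1).1 hY
  set c := ∫ ω, ‖Y ω‖ ∂μ with hc
  have h : 0 ≤ ∫ ω, (‖Y ω‖ - c) ^ 2 ∂μ := integral_nonneg fun _ => sq_nonneg _
  have e : ∀ ω, (‖Y ω‖ - c) ^ 2 = ‖Y ω‖ ^ 2 - 2 * c * ‖Y ω‖ + c ^ 2 := fun ω => by ring
  have hi3 : Integrable (fun ω => ‖Y ω‖ ^ 2 - 2 * c * ‖Y ω‖) μ := hi2.sub (hi.const_mul _)
  simp_rw [e] at h
  rw [integral_add hi3 (integrable_const _), integral_sub hi2 (hi.const_mul _), integral_const_mul, ← hc] at h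
  simp at h
  linarith

variable [InnerProductSpace ℝ E]

theorem integrable_inner_of_memLp_two {μ : Measure Ω} {X Y : Ω → E}
    (hX : MemLp X 2 μ) (hY : MemLp Y 2 μ) : Integrable (fun ω => ⟪X ω, Y ω⟫) μ := by
  have hi := ((memLp_two_iff_integrable_sq_norm hX.1).1 hX).add
    ((memLp_two_iff_integrable_sq_norm hY.1).1 hY)
  refine hi.mono' (hX.1.inner hY.1) (Filter.Eventually.of_forall fun ω => ?_)
  have h1 := norm_inner_le_norm (𝕜 := ℝ) (X ω) (Y ω)
  simp only [Pi.add_apply]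
  nlinarith [sq_nonneg (‖X ω‖ - ‖Y ω‖), sq_nonneg (‖X ω‖), sq_nonneg (‖Y ω‖)]

theorem integral_sq_norm_const_add [CompleteSpace E] {P : Measure Ξ} [IsProbabilityMeasure P]
    {W : Ξ → E} (hW : MemLp W 2 P) (h0 : ∫ ξ, W ξ ∂P = 0) (c : E) :
    ∫ ξ, ‖c + W ξ‖ ^ 2 ∂P = ‖c‖ ^ 2 + ∫ ξ, ‖W ξ‖ ^ 2 ∂P := by
  have hi : Integrable W P := hW.integrable (by norm_num)
  have h1 : ∀ ξ, ‖c + W ξ‖ ^ 2 = (‖c‖ ^ 2 + 2 * ⟪c, W ξ⟫) + ‖W ξ‖ ^ 2 := fun ξ =>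
    norm_add_sq_real c (W ξ)
  have hi2 : Integrable (fun ξ => 2 * ⟪c, W ξ⟫) P := (hi.const_inner c).const_mul 2
  have hi3 : Integrable (fun ξ => ‖c‖ ^ 2 + 2 * ⟪c, W ξ⟫) P := (integrable_const _).add hi2
  simp_rw [h1]
  rw [integral_add hi3 ((memLp_two_iff_integrable_sq_norm hW.1).1 hW),
    integral_add (integrable_const _) hi2, integral_const_mul, integral_inner hi, h0]
  simp

theorem integral_sq_norm_sub_integral_le [CompleteSpace E] {P : Measure Ξ}
    [IsProbabilityMeasure P] {D : Ξ → E} (hD : MemLp D 2 P) :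
    ∫ ξ, ‖D ξ - ∫ ζ, D ζ ∂P‖ ^ 2 ∂P ≤ ∫ ξ, ‖D ξ‖ ^ 2 ∂P := by
  have hi : Integrable D P := hD.integrable (by norm_num)
  have h0 : ∫ ξ, (D ξ - ∫ ζ, D ζ ∂P) ∂P = 0 := by
    rw [integral_sub hi (integrable_const _)]; simp
  have h := integral_sq_norm_const_add (hD.sub (memLp_const (∫ ζ, D ζ ∂P))) h0 (∫ ζ, D ζ ∂P)
  simp only [Pi.sub_apply, add_sub_cancel] at h
  rw [h]
  linarith [sq_nonneg ‖∫ ζ, D ζ ∂P‖]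

/-- Shape of the estimator error: `c` is the inherited error, `D` the oracle difference, `N` the
fresh noise. The random part has mean zero, so it adds to ‖c‖² without a cross term, and centering
`D` does not increase its second moment. -/
theorem integral_sq_norm_add_centered_le [CompleteSpace E] {P : Measure Ξ}
    [IsProbabilityMeasure P] {D N : Ξ → E} (hD : MemLp D 2 P) (hN : MemLp N 2 P)
    (hN0 : ∫ ξ, N ξ ∂P = 0) (c : E) (s t : ℝ) :
    MemLp (fun ξ => c + (s • (D ξ - ∫ ζ, D ζ ∂P) + t • N ξ)) 2 P ∧
    ∫ ξ, ‖c + (s • (D ξ - ∫ ζ, D ζ ∂P) + t • N ξ)‖ ^ 2 ∂P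
      ≤ ‖c‖ ^ 2 + 2 * s ^ 2 * ∫ ξ, ‖D ξ‖ ^ 2 ∂P + 2 * t ^ 2 * ∫ ξ, ‖N ξ‖ ^ 2 ∂P := by
  obtain ⟨D₀, hD₀e⟩ : ∃ D₀ : Ξ → E, ∀ ξ, D₀ ξ = D ξ - ∫ ζ, D ζ ∂P := ⟨_, fun _ => rfl⟩
  have hD₀ : MemLp (fun ξ => D ξ - ∫ ζ, D ζ ∂P) 2 P := hD.sub (memLp_const _)
  have hcen := integral_sq_norm_sub_integral_le hD
  have i1 : ∫ ξ, (D ξ - ∫ ζ, D ζ ∂P) ∂P = 0 := by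
    rw [integral_sub (hD.integrable (by norm_num)) (integrable_const _)]; simp
  simp_rw [← hD₀e] at hD₀ hcen i1 ⊢
  have hW : MemLp (fun ξ => s • D₀ ξ + t • N ξ) 2 P := (hD₀.const_smul s).add (hN.const_smul t)
  have hW0 : ∫ ξ, (s • D₀ ξ + t • N ξ) ∂P = 0 := by
    have i3 : Integrable (fun ξ => s • D₀ ξ) P := (hD₀.integrable (by norm_num)).smul s
    have i4 : Integrable (fun ξ => t • N ξ) P := (hN.integrable (by norm_num)).smul t
    rw [integral_add i3 i4, integral_smul, integral_smul, i1, hN0]; simp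
  refine ⟨(memLp_const c).add hW, ?_⟩
  rw [integral_sq_norm_const_add hW hW0]
  have hsqD := (memLp_two_iff_integrable_sq_norm hD₀.1).1 hD₀
  have hsqN := (memLp_two_iff_integrable_sq_norm hN.1).1 hN
  have h1 : ∫ ξ, ‖s • D₀ ξ + t • N ξ‖ ^ 2 ∂P
      ≤ ∫ ξ, (2 * s ^ 2 * ‖D₀ ξ‖ ^ 2 + 2 * t ^ 2 * ‖N ξ‖ ^ 2) ∂P := by
    refine integral_mono ((memLp_two_iff_integrable_sq_norm hW.1).1 hW)
      ((hsqD.const_mul _).add (hsqN.const_mul _)) fun ξ => ?_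
    have h2 : ‖s • D₀ ξ + t • N ξ‖ ≤ |s| * ‖D₀ ξ‖ + |t| * ‖N ξ‖ := by
      refine (norm_add_le _ _).trans ?_
      rw [norm_smul, norm_smul, Real.norm_eq_abs, Real.norm_eq_abs]
    calc ‖s • D₀ ξ + t • N ξ‖ ^ 2 ≤ (|s| * ‖D₀ ξ‖ + |t| * ‖N ξ‖) ^ 2 := by gcongr
      _ ≤ 2 * ((|s| * ‖D₀ ξ‖) ^ 2 + (|t| * ‖N ξ‖) ^ 2) := add_sq_le
      _ = _ := by rw [mul_pow, mul_pow, sq_abs, sq_abs]; ring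
  rw [integral_add (hsqD.const_mul _) (hsqN.const_mul _), integral_const_mul,
    integral_const_mul] at h1
  have h5 := mul_le_mul_of_nonneg_left hcen (by positivity : 0 ≤ 2 * s ^ 2)
  linarith

end SecondMoments

/-! ### The oracle, the estimator for a frozen state, and independence of the next sample. -/

namespace LinConsProblem

variable {Ξ : Type*} [MeasurableSpace Ξ] {d n : ℕ} {p : LinConsProblem Ξ d n} {L V fLow : ℝ}

namespace Assumptions

theorem measurable_oracle_apply (hp : p.Assumptions L V fLow) (x : EuclideanSpace ℝ (Fin d)) :
    Measurable (p.oracle x) :=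
  hp.measurable_oracle.comp measurable_prodMk_left

theorem memLp_oracle_sub_gradient (hp : p.Assumptions L V fLow)
    (x : EuclideanSpace ℝ (Fin d)) : MemLp (fun ξ => p.oracle x ξ - gradient p.f x) 2 p.P :=
  memLp_two_of_lintegral_sq_le
    ((hp.measurable_oracle_apply x).sub measurable_const).aestronglyMeasurable (hp.variance_le x)

theorem integral_sq_norm_oracle_sub_gradient_le (hp : p.Assumptions L V fLow)
    (x : EuclideanSpace ℝ (Fin d)) : ∫ ξ, ‖p.oracle x ξ - gradient p.f x‖ ^ 2 ∂p.P ≤ V ^ 2 :=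
  integral_sq_norm_le_of_lintegral_sq_le
    ((hp.measurable_oracle_apply x).sub measurable_const).aestronglyMeasurable (sq_nonneg V)
    (hp.variance_le x)

theorem memLp_oracle (hp : p.Assumptions L V fLow) (x : EuclideanSpace ℝ (Fin d)) :
    MemLp (p.oracle x) 2 p.P := by
  have := hp.prob
  have h := (hp.memLp_oracle_sub_gradient x).add (memLp_const (gradient p.f x))
  refine h.congr_norm (hp.measurable_oracle_apply x).aestronglyMeasurable
    (Filter.Eventually.of_forall fun ξ => ?_)
  simp

theorem integrable_oracle (hp : p.Assumptions L V fLow) (x : EuclideanSpace ℝ (Fin d)) :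
    Integrable (p.oracle x) p.P :=
  have := hp.prob
  (hp.memLp_oracle x).integrable (by norm_num)

theorem memLp_oracle_sub (hp : p.Assumptions L V fLow) (u v : EuclideanSpace ℝ (Fin d)) :
    MemLp (fun ξ => p.oracle u ξ - p.oracle v ξ) 2 p.P :=
  (hp.memLp_oracle u).sub (hp.memLp_oracle v)

theorem integral_sq_norm_oracle_sub_le (hp : p.Assumptions L V fLow)
    (u v : EuclideanSpace ℝ (Fin d)) :
    ∫ ξ, ‖p.oracle u ξ - p.oracle v ξ‖ ^ 2 ∂p.P ≤ L ^ 2 * ‖u - v‖ ^ 2 :=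
  integral_sq_norm_le_of_lintegral_sq_le (hp.memLp_oracle_sub u v).1 (by positivity)
    (hp.meanSquareSmooth u v)

theorem integral_oracle_sub (hp : p.Assumptions L V fLow) (u v : EuclideanSpace ℝ (Fin d)) :
    ∫ ξ, (p.oracle u ξ - p.oracle v ξ) ∂p.P = gradient p.f u - gradient p.f v := by
  rw [integral_sub (hp.integrable_oracle u) (hp.integrable_oracle v), hp.unbiased, hp.unbiased]

/-- By unbiasedness and Jensen, mean-square smoothness of the oracle passes to ∇f. -/
theorem norm_gradient_sub_le (hp : p.Assumptions L V fLow) (hL : 0 < L)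
    (u v : EuclideanSpace ℝ (Fin d)) :
    ‖gradient p.f u - gradient p.f v‖ ≤ L * ‖u - v‖ := by
  have := hp.prob
  have h1 : ‖gradient p.f u - gradient p.f v‖ ≤ ∫ ξ, ‖p.oracle u ξ - p.oracle v ξ‖ ∂p.P := by
    rw [← hp.integral_oracle_sub]; exact norm_integral_le_integral_norm _
  refine h1.trans (le_of_pow_le_pow_left₀ two_ne_zero (by positivity) ?_)
  rw [mul_pow]
  exact (sq_integral_norm_le (hp.memLp_oracle_sub u v)).trans
    (hp.integral_sq_norm_oracle_sub_le u v)

theorem continuous_gradient (hp : p.Assumptions L V fLow) (hL : 0 < L) :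
    Continuous (gradient p.f) := by
  refine (LipschitzWith.of_dist_le_mul (K := ⟨L, hL.le⟩) fun x y => ?_).continuous
  rw [dist_eq_norm, dist_eq_norm]
  exact hp.norm_gradient_sub_le hL x y

/-- Error recursion of the recursive-momentum estimator for a frozen state. -/
theorem lintegral_sq_error_le (hp : p.Assumptions L V fLow)
    (x x' g : EuclideanSpace ℝ (Fin d)) (α : ℝ) :
    ∫⁻ ξ, ‖p.oracle x' ξ + (1 - α) • (g - p.oracle x ξ) - gradient p.f x'‖ₑ ^ 2 ∂p.P ≤
      ENNReal.ofReal ((1 - α) ^ 2 * ‖g - gradient p.f x‖ ^ 2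
        + 2 * (1 - α) ^ 2 * L ^ 2 * ‖x' - x‖ ^ 2 + 2 * α ^ 2 * V ^ 2) := by
  have := hp.prob
  have hN0 : ∫ ξ, (p.oracle x' ξ - gradient p.f x') ∂p.P = 0 := by
    rw [integral_sub (hp.integrable_oracle x') (integrable_const _), hp.unbiased]; simp
  obtain ⟨hm, hle⟩ := integral_sq_norm_add_centered_le (hp.memLp_oracle_sub x' x)
    (hp.memLp_oracle_sub_gradient x') hN0 ((1 - α) • (g - gradient p.f x)) (1 - α) α
  -- The old error and the centered oracle difference both carry 1 - α; only the factor α multiplies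
  -- the new noise.
  have hdecomp : ∀ ξ, p.oracle x' ξ + (1 - α) • (g - p.oracle x ξ) - gradient p.f x'
      = (1 - α) • (g - gradient p.f x) + ((1 - α) • ((p.oracle x' ξ - p.oracle x ξ)
        - ∫ ζ, (p.oracle x' ζ - p.oracle x ζ) ∂p.P) + α • (p.oracle x' ξ - gradient p.f x')) := by
    intro ξ
    rw [hp.integral_oracle_sub]
    module
  simp_rw [hdecomp]
  rw [lintegral_sq_enorm_eq hm]
  refine ENNReal.ofReal_le_ofReal (hle.trans ?_)
  rw [norm_smul, mul_pow, Real.norm_eq_abs, sq_abs]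
  have h5 := mul_le_mul_of_nonneg_left (hp.integral_sq_norm_oracle_sub_le x' x)
    (by positivity : 0 ≤ 2 * (1 - α) ^ 2)
  have h6 := mul_le_mul_of_nonneg_left (hp.integral_sq_norm_oracle_sub_gradient_le x')
    (by positivity : 0 ≤ 2 * α ^ 2)
  linarith

/-- Increment of the recursive-momentum estimator for a frozen state. -/
theorem lintegral_sq_increment_le (hp : p.Assumptions L V fLow)
    (x x' g : EuclideanSpace ℝ (Fin d)) (α : ℝ) :
    ∫⁻ ξ, ‖p.oracle x' ξ + (1 - α) • (g - p.oracle x ξ) - g‖ₑ ^ 2 ∂p.P ≤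
      ENNReal.ofReal (4 * α ^ 2 * ‖g - gradient p.f x‖ ^ 2
        + 2 * L ^ 2 * ‖x' - x‖ ^ 2 + 4 * α ^ 2 * V ^ 2) := by
  have := hp.prob
  set D : Ξ → EuclideanSpace ℝ (Fin d) := fun ξ => p.oracle x' ξ - p.oracle x ξ with hDdef
  set N : Ξ → EuclideanSpace ℝ (Fin d) := fun ξ => p.oracle x ξ - gradient p.f x with hN
  have hD : MemLp D 2 p.P := hp.memLp_oracle_sub x' x
  have hNm : MemLp N 2 p.P := hp.memLp_oracle_sub_gradient x
  set e := g - gradient p.f x with he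
  -- Here the noise is taken at the old point, so that it and the old error enter only with α. No
  -- centering is used, hence the cruder constants 2 and 4.
  have hdecomp : ∀ ξ, p.oracle x' ξ + (1 - α) • (g - p.oracle x ξ) - g
      = D ξ + α • (N ξ - e) := by
    intro ξ
    simp only [hN, hDdef, he]
    module
  simp_rw [hdecomp]
  have hm : MemLp (fun ξ => D ξ + α • (N ξ - e)) 2 p.P :=
    hD.add ((hNm.sub (memLp_const e)).const_smul α)
  rw [lintegral_sq_enorm_eq hm]
  refine ENNReal.ofReal_le_ofReal ?_
  have hsqD := (memLp_two_iff_integrable_sq_norm hD.1).1 hD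
  have hsqN := (memLp_two_iff_integrable_sq_norm hNm.1).1 hNm
  have h1 : ∫ ξ, ‖D ξ + α • (N ξ - e)‖ ^ 2 ∂p.P
      ≤ ∫ ξ, (2 * ‖D ξ‖ ^ 2 + 4 * α ^ 2 * ‖N ξ‖ ^ 2 + 4 * α ^ 2 * ‖e‖ ^ 2) ∂p.P := by
    refine integral_mono ((memLp_two_iff_integrable_sq_norm hm.1).1 hm)
      (((hsqD.const_mul _).add (hsqN.const_mul _)).add (integrable_const _)) fun ξ => ?_
    have h2 : ‖D ξ + α • (N ξ - e)‖ ≤ ‖D ξ‖ + |α| * (‖N ξ‖ + ‖e‖) := by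
      refine (norm_add_le _ _).trans ?_
      rw [norm_smul, Real.norm_eq_abs]
      gcongr
      exact norm_sub_le _ _
    have h3 : (‖N ξ‖ + ‖e‖) ^ 2 ≤ 2 * (‖N ξ‖ ^ 2 + ‖e‖ ^ 2) := add_sq_le
    calc ‖D ξ + α • (N ξ - e)‖ ^ 2 ≤ (‖D ξ‖ + |α| * (‖N ξ‖ + ‖e‖)) ^ 2 := by gcongr
      _ ≤ 2 * (‖D ξ‖ ^ 2 + (|α| * (‖N ξ‖ + ‖e‖)) ^ 2) := add_sq_le
      _ = 2 * ‖D ξ‖ ^ 2 + 2 * α ^ 2 * (‖N ξ‖ + ‖e‖) ^ 2 := by rw [mul_pow, sq_abs]; ring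
      _ ≤ 2 * ‖D ξ‖ ^ 2 + 2 * α ^ 2 * (2 * (‖N ξ‖ ^ 2 + ‖e‖ ^ 2)) := by gcongr
      _ = _ := by ring
  have hi3 : Integrable (fun ξ => 2 * ‖D ξ‖ ^ 2 + 4 * α ^ 2 * ‖N ξ‖ ^ 2) p.P :=
    (hsqD.const_mul _).add (hsqN.const_mul _)
  rw [integral_add hi3 (integrable_const _), integral_add (hsqD.const_mul _) (hsqN.const_mul _), integral_const_mul,
    integral_const_mul] at h1
  simp only [integral_const, probReal_univ, smul_eq_mul, one_mul] at h1
  have h3 : ∫ ξ, ‖D ξ‖ ^ 2 ∂p.P ≤ L ^ 2 * ‖x' - x‖ ^ 2 := hp.integral_sq_norm_oracle_sub_le x' x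
  have h4 : ∫ ξ, ‖N ξ‖ ^ 2 ∂p.P ≤ V ^ 2 := hp.integral_sq_norm_oracle_sub_gradient_le x
  have h6 := mul_le_mul_of_nonneg_left h4 (by positivity : 0 ≤ 4 * α ^ 2)
  linarith

end Assumptions

section Run

variable {ρ : ℝ} {η α : ℕ → ℝ} {x₀ : EuclideanSpace ℝ (Fin d)} {lam₀ : EuclideanSpace ℝ (Fin n)}
  {g₀ : EuclideanSpace ℝ (Fin d)}

/-- State k reads only the samples with index below k; its independence from sample k rests on this.
-/
theorem run_congr {y y' : ℕ → Ξ} {k : ℕ} (h : ∀ i < k, y i = y' i) :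
    p.run ρ η α x₀ lam₀ g₀ y k = p.run ρ η α x₀ lam₀ g₀ y' k := by
  induction k with
  | zero => rfl
  | succ k ih =>
    rw [run, run, ih fun i hi => h i (hi.trans (Nat.lt_succ_self k)), h k (Nat.lt_succ_self k)]

theorem calls_run (y : ℕ → Ξ) (k : ℕ) : (p.run ρ η α x₀ lam₀ g₀ y k).calls = 2 * k := by
  induction k with
  | zero => rfl
  | succ k ih =>
    change (p.run ρ η α x₀ lam₀ g₀ y k).calls + 1 + 1 = 2 * (k + 1)
    rw [ih]; ring

theorem Assumptions.measurable_run (hp : p.Assumptions L V fLow) (k : ℕ) :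
    Measurable (fun y : ℕ → Ξ => (p.run ρ η α x₀ lam₀ g₀ y k).x) ∧
    Measurable (fun y : ℕ → Ξ => (p.run ρ η α x₀ lam₀ g₀ y k).lam) ∧
    Measurable (fun y : ℕ → Ξ => (p.run ρ η α x₀ lam₀ g₀ y k).g) := by
  induction k with
  | zero => exact ⟨measurable_const, measurable_const, measurable_const⟩
  | succ k ih =>
    obtain ⟨hx, hl, hg⟩ := ih
    have hx' : Measurable (fun y : ℕ → Ξ => (p.run ρ η α x₀ lam₀ g₀ y (k + 1)).x) := by
      change Measurable fun y : ℕ → Ξ => (p.run ρ η α x₀ lam₀ g₀ y k).x -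
        η (k + 1) • ((p.run ρ η α x₀ lam₀ g₀ y k).g + p.At (p.run ρ η α x₀ lam₀ g₀ y k).lam
          + ρ • p.At (p.A (p.run ρ η α x₀ lam₀ g₀ y k).x - p.b))
      fun_prop
    refine ⟨hx', ?_, ?_⟩
    · change Measurable fun y : ℕ → Ξ => (p.run ρ η α x₀ lam₀ g₀ y k).lam +
        ρ • (p.A (p.run ρ η α x₀ lam₀ g₀ y (k + 1)).x - p.b)
      fun_prop
    · change Measurable fun y : ℕ → Ξ => p.oracle (p.run ρ η α x₀ lam₀ g₀ y (k + 1)).x (y k) +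
        (1 - α (k + 1)) • ((p.run ρ η α x₀ lam₀ g₀ y k).g
          - p.oracle (p.run ρ η α x₀ lam₀ g₀ y k).x (y k))
      have h1 : Measurable fun y : ℕ → Ξ =>
          p.oracle (p.run ρ η α x₀ lam₀ g₀ y (k + 1)).x (y k) :=
        hp.measurable_oracle.comp (hx'.prodMk (measurable_pi_apply k))
      have h2 : Measurable fun y : ℕ → Ξ => p.oracle (p.run ρ η α x₀ lam₀ g₀ y k).x (y k) :=
        hp.measurable_oracle.comp (hx.prodMk (measurable_pi_apply k))
      fun_prop

/-- The state after `k` iterations is independent of the sample drawn in the next iteration. -/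
theorem Assumptions.indepFun_run (hp : p.Assumptions L V fLow) {Ω : Type*} [MeasurableSpace Ω]
    {μ : Measure Ω} {ξ : ℕ → Ω → Ξ} (hξ : ∀ k, Measurable (ξ k))
    (hind : iIndepFun ξ μ) (k : ℕ) :
    IndepFun (fun ω => ((p.run ρ η α x₀ lam₀ g₀ (fun i => ξ i ω) k).x,
      (p.run ρ η α x₀ lam₀ g₀ (fun i => ξ i ω) k).lam,
      (p.run ρ η α x₀ lam₀ g₀ (fun i => ξ i ω) k).g)) (ξ k) μ := by
  have := hp.prob
  obtain ⟨default⟩ : Nonempty Ξ := nonempty_of_isProbabilityMeasure p.P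
  -- Pad the first k samples with an arbitrary value, which makes state k a measurable function of
  -- these samples alone.
  let ext : (↥(Finset.range k) → Ξ) → ℕ → Ξ := fun z i =>
    if h : i ∈ Finset.range k then z ⟨i, h⟩ else default
  have hext : Measurable ext := by
    refine measurable_pi_lambda _ fun i => ?_
    by_cases h : i ∈ Finset.range k
    · simp only [ext, h, dif_pos]
      exact measurable_pi_apply _
    · simp only [ext, h, dif_neg, not_false_iff]
      exact measurable_const
  have hdisj : Disjoint (Finset.range k) {k} := by simp
  have h1 := hind.indepFun_finset (Finset.range k) {k} hdisj hξ
  obtain ⟨hx, hl, hg⟩ := hp.measurable_run (ρ := ρ) (η := η) (α := α) (x₀ := x₀) (lam₀ := lam₀)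
    (g₀ := g₀) k
  have h2 := h1.comp ((hx.prodMk (hl.prodMk hg)).comp hext)
    (measurable_pi_apply (⟨k, Finset.mem_singleton_self k⟩ : ↥({k} : Finset ℕ)))
  have heq : ∀ ω, p.run ρ η α x₀ lam₀ g₀ (ext fun i => ξ i ω) k
      = p.run ρ η α x₀ lam₀ g₀ (fun i => ξ i ω) k := by
    intro ω
    refine run_congr fun i hi => ?_
    simp [ext, hi]
  have hfun : (fun ω => ((p.run ρ η α x₀ lam₀ g₀ (fun i => ξ i ω) k).x,
      (p.run ρ η α x₀ lam₀ g₀ (fun i => ξ i ω) k).lam,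
      (p.run ρ η α x₀ lam₀ g₀ (fun i => ξ i ω) k).g)) =
      ((fun y => ((p.run ρ η α x₀ lam₀ g₀ y k).x, (p.run ρ η α x₀ lam₀ g₀ y k).lam,
        (p.run ρ η α x₀ lam₀ g₀ y k).g)) ∘ ext) ∘ fun ω (i : ↥(Finset.range k)) => ξ i ω := by
    funext ω
    simp only [Function.comp_apply, heq]
  rw [hfun]
  exact h2

end Run

end LinConsProblem

/-! ### The decrease of the full potential in expectation. -/

section ExpectedPotential

/-- The weight 2/(121L²h) makes the contraction worth -2h'Ee, which outweighs the h'Ee from the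
Lagrangian, 24/121 from the growth of 1/h, and 1/1000 from the increment. The weight on Ei cancels
the Ei in `hlag`. The terms h/16·EG and ρ/4·ER store decrease to cover the next step's h/100·EG and
ρ/8·ER. The noise is 484 + 100 ≤ 600. -/
theorem expected_potential_step_le {L V ρ M fLow h h' EL EL' ER ER' EG EG' Ee Ee' Ei Ei' α : ℝ}
    (hL : 0 < L) (hρ : 0 < ρ) (hLM : L ≤ M) (hs : StepPair L M h h') (hα : α = 121 * L ^ 2 * h' ^ 2)
    (hER : 0 ≤ ER) (hER' : 0 ≤ ER') (hEG : 0 ≤ EG) (hEG' : 0 ≤ EG') (hEe : 0 ≤ Ee)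
    (hlag : EL' + 1 / (100 * L) * (ρ / (2 * h') * ER' + 1 / 2 * EG') + ρ * ER'
      ≤ EL + 1 / (100 * L) * (ρ / (2 * h) * ER + 1 / 2 * EG) + ρ / 8 * ER
        + h' * Ee - 1 / 2 * h' * EG' + 1 / 100 * h * EG + 3 * (1 / (100 * L)) ^ 2 / h * Ei)
    (herr : Ee' ≤ (1 - α) ^ 2 * Ee + 2 * (1 - α) ^ 2 * L ^ 2 * (h' ^ 2 * EG') + 2 * α ^ 2 * V ^ 2)
    (hinc : Ei' ≤ 4 * α ^ 2 * Ee + 2 * L ^ 2 * (h' ^ 2 * EG') + 4 * α ^ 2 * V ^ 2) :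
    EL' - fLow + 1 / (100 * L) * (ρ / (2 * h') * ER' + 1 / 2 * EG') + ρ / 4 * ER'
        + 2 / (121 * L ^ 2) / h' * Ee' + 3 * (1 / (100 * L)) ^ 2 / h' * Ei' + h' / 16 * EG'
      ≤ EL - fLow + 1 / (100 * L) * (ρ / (2 * h) * ER + 1 / 2 * EG) + ρ / 4 * ER
        + 2 / (121 * L ^ 2) / h * Ee + 3 * (1 / (100 * L)) ^ 2 / h * Ei + h / 16 * EG
        - 1 / 4 * (h' * EG' + h' * Ee + ρ * ER') + 600 * L ^ 2 * V ^ 2 * h' ^ 3 := by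
  have hh' := hs.pos
  have hh : 0 < h := hh'.trans_le hs.le
  have hLh' : L * h' ≤ 1 / 1000 :=
    (mul_le_mul hLM hs.le hh'.le (by linarith)).trans hs.mul_le
  have hLh0 : 0 < L * h' := by positivity
  have hsq : (L * h') ^ 2 ≤ (1 / 1000) ^ 2 := by gcongr
  have hα0 : 0 ≤ α := by rw [hα]; positivity
  have hα1 : α ≤ 1 := by
    rw [hα, mul_assoc, ← mul_pow]; norm_num at hsq; linarith
  have h1α : (1 - α) ^ 2 ≤ 1 - α := by
    have := mul_nonneg hα0 (sub_nonneg.2 hα1)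
    linarith only [this]
  have t1 : 2 / (121 * L ^ 2) / h' * Ee' ≤ 2 / (121 * L ^ 2) / h * Ee
      + (24 / 121 - 2) * (h' * Ee) + 4 / 121 * (h' * EG')
      + 484 * L ^ 2 * V ^ 2 * h' ^ 3 := by
    have a1 : Ee' ≤ (1 - α) * Ee + 2 * L ^ 2 * (h' ^ 2 * EG') + 2 * α ^ 2 * V ^ 2 := by
      refine herr.trans ?_
      have b1 := mul_le_mul_of_nonneg_right h1α hEe
      have b2 := mul_le_mul_of_nonneg_right (h1α.trans (by linarith : 1 - α ≤ 1))
        (by positivity : 0 ≤ 2 * L ^ 2 * (h' ^ 2 * EG'))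
      linarith only [b1, b2]
    have a2 := mul_le_mul_of_nonneg_left a1 (by positivity : 0 ≤ 2 / (121 * L ^ 2) / h')
    have a3 : 2 / (121 * L ^ 2) / h' * ((1 - α) * Ee + 2 * L ^ 2 * (h' ^ 2 * EG')
        + 2 * α ^ 2 * V ^ 2) = 2 / (121 * L ^ 2) * h'⁻¹ * Ee - 2 * (h' * Ee)
        + 4 / 121 * (h' * EG') + 484 * L ^ 2 * V ^ 2 * h' ^ 3 := by
      rw [hα]; field_simp; ring
    have a4 : 2 / (121 * L ^ 2) * h'⁻¹ * Ee
        ≤ 2 / (121 * L ^ 2) * (h⁻¹ + 12 * L ^ 2 * h') * Ee := by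
      gcongr
      linarith only [hs.inv_sub_inv_le]
    have a5 : 2 / (121 * L ^ 2) * (h⁻¹ + 12 * L ^ 2 * h') * Ee
        = 2 / (121 * L ^ 2) / h * Ee + 24 / 121 * (h' * Ee) := by
      field_simp; ring
    linarith only [a2, a3, a4, a5]
  have t2 : 3 * (1 / (100 * L)) ^ 2 / h' * Ei' ≤ 1 / 1000 * (h' * Ee)
      + 1 / 1000 * (h' * EG') + 100 * L ^ 2 * V ^ 2 * h' ^ 3 := by
    have a2 := mul_le_mul_of_nonneg_left hinc (by positivity : 0 ≤ 3 * (1 / (100 * L)) ^ 2 / h')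
    have a3 : 3 * (1 / (100 * L)) ^ 2 / h' * (4 * α ^ 2 * Ee + 2 * L ^ 2 * (h' ^ 2 * EG')
        + 4 * α ^ 2 * V ^ 2) = 12 * 14641 / 10000 * (L * h') ^ 2 * (h' * Ee)
        + 6 / 10000 * (h' * EG') + 12 * 14641 / 10000 * (L ^ 2 * V ^ 2 * h' ^ 3) := by
      rw [hα]; field_simp; ring
    have a4 : 12 * 14641 / 10000 * (L * h') ^ 2 * (h' * Ee)
        ≤ 12 * 14641 / 10000 * (1 / 1000) ^ 2 * (h' * Ee) := by gcongr
    have a5 : 0 ≤ h' * Ee := by positivity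
    have a6 : 0 ≤ h' * EG' := by positivity
    have a7 : 0 ≤ L ^ 2 * V ^ 2 * h' ^ 3 := by positivity
    linarith only [a2, a3, a4, a5, a6, a7]
  have a5 : 0 ≤ h' * Ee := by positivity
  have a6 : 0 ≤ h' * EG' := by positivity
  have a7 : 0 ≤ L ^ 2 * V ^ 2 * h' ^ 3 := by positivity
  have a8 : 0 ≤ h * EG := by positivity
  have a9 : 0 ≤ ρ * ER := by positivity
  have a10 : 0 ≤ ρ * ER' := by positivity
  linarith only [hlag, t1, t2, a5, a6, a7, a8, a9, a10]

/-- Summed decrease along the expected iterates. -/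
theorem expected_sum_le {L V ρ M fLow S₀ S₃ : ℝ} {h α EL ER EG Ee Ei El : ℕ → ℝ}
    (hL : 0 < L) (hρ : 0 < ρ) (hLM : L ≤ M) (hs : ∀ k, StepPair L M (h k) (h (k + 1)))
    (hα : ∀ k, α k = 121 * L ^ 2 * h k ^ 2)
    (hER : ∀ k, 0 ≤ ER k) (hEG : ∀ k, 0 ≤ EG k) (hEe : ∀ k, 0 ≤ Ee k) (hEi : ∀ k, 0 ≤ Ei k)
    (hEl : ∀ k, 0 ≤ El k)
    (hlag : ∀ k, EL (k + 1) + 1 / (100 * L) * (ρ / (2 * h (k + 1)) * ER (k + 1)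
        + 1 / 2 * EG (k + 1)) + ρ * ER (k + 1)
      ≤ EL k + 1 / (100 * L) * (ρ / (2 * h k) * ER k + 1 / 2 * EG k) + ρ / 8 * ER k
        + h (k + 1) * Ee k - 1 / 2 * h (k + 1) * EG (k + 1) + 1 / 100 * h k * EG k
        + 3 * (1 / (100 * L)) ^ 2 / h k * Ei k)
    (herr : ∀ k, Ee (k + 1) ≤ (1 - α (k + 1)) ^ 2 * Ee k
      + 2 * (1 - α (k + 1)) ^ 2 * L ^ 2 * (h (k + 1) ^ 2 * EG (k + 1))
      + 2 * α (k + 1) ^ 2 * V ^ 2)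
    (hinc : ∀ k, Ei (k + 1) ≤ 4 * α (k + 1) ^ 2 * Ee k
      + 2 * L ^ 2 * (h (k + 1) ^ 2 * EG (k + 1)) + 4 * α (k + 1) ^ 2 * V ^ 2)
    (hlow : ∀ k, (El (k + 1) - El k) / (2 * ρ) ≤ EL (k + 1) - fLow)
    (hinit : EL 0 - fLow + 1 / (100 * L) * (ρ / (2 * h 0) * ER 0 + 1 / 2 * EG 0) + ρ / 4 * ER 0
        + 2 / (121 * L ^ 2) / h 0 * Ee 0 + 3 * (1 / (100 * L)) ^ 2 / h 0 * Ei 0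
        + h 0 / 16 * EG 0 ≤ S₀)
    (hsum : ∀ T, ∑ k ∈ Finset.range T, h (k + 1) ^ 3 ≤ S₃) (T : ℕ) :
    ∑ k ∈ Finset.range T, (h (k + 1) * EG (k + 1) + h (k + 1) * Ee k + ρ * ER (k + 1))
      ≤ 4 * (S₀ + 600 * L ^ 2 * V ^ 2 * S₃) := by
  have hpos : ∀ k, 0 < h k := fun k => (hs k).pos.trans_le (hs k).le
  have key := sum_le_of_potential
    (Φ := fun k => EL k - fLow + 1 / (100 * L) * (ρ / (2 * h k) * ER k + 1 / 2 * EG k)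
      + ρ / 4 * ER k + 2 / (121 * L ^ 2) / h k * Ee k + 3 * (1 / (100 * L)) ^ 2 / h k * Ei k
      + h k / 16 * EG k)
    (q := fun k => 1 / 4 * (h (k + 1) * EG (k + 1) + h (k + 1) * Ee k + ρ * ER (k + 1)))
    (e := fun k => 600 * L ^ 2 * V ^ 2 * h (k + 1) ^ 3) (s := fun k => El k / (2 * ρ))
    (S := 600 * L ^ 2 * V ^ 2 * S₃)
    (fun k => expected_potential_step_le hL hρ hLM (hs k) (hα (k + 1)) (hER k) (hER (k + 1))
      (hEG k) (hEG (k + 1)) (hEe k) (hlag k) (herr k) (hinc k))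
    (fun k => by
      have := hpos (k + 1); have := hEG (k + 1); have := hEe k; have := hER (k + 1)
      positivity)
    (fun T => by
      rw [← Finset.mul_sum]
      exact mul_le_mul_of_nonneg_left (hsum T) (by positivity))
    (fun k => by have := hEl k; positivity)
    -- Apart from the augmented Lagrangian all terms of the potential are nonnegative, so the bound
    -- by the increment of the multipliers' second moment carries over.
    (fun k => by
      have h1 := hlow k
      have := hpos (k + 1); have := hEG (k + 1); have := hEe (k + 1); have := hER (k + 1)
      have := hEi (k + 1)
      have h2 : 0 ≤ 1 / (100 * L) * (ρ / (2 * h (k + 1)) * ER (k + 1) + 1 / 2 * EG (k + 1))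
        + ρ / 4 * ER (k + 1) + 2 / (121 * L ^ 2) / h (k + 1) * Ee (k + 1)
        + 3 * (1 / (100 * L)) ^ 2 / h (k + 1) * Ei (k + 1) + h (k + 1) / 16 * EG (k + 1) := by
        positivity
      rw [← sub_div]
      linarith only [h1, h2]) T
  rw [← Finset.mul_sum] at key
  linarith only [key, hinit]

end ExpectedPotential

/-! ### Random output index. -/

section UniformIndex

variable {Ω T : Type*} [MeasurableSpace Ω] [MeasurableSpace T]

/-- Averaging over an independent index that is uniform on `{1, …, K}`. -/
theorem integral_uniform_index {μ : Measure Ω} [IsProbabilityMeasure μ] {K : ℕ}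
    {kHat : Ω → ℕ} (hk : Measurable kHat) (hunif : μ.map kHat = uniformOn (Set.Icc 1 K))
    {Z : Ω → T} (hind : IndepFun kHat Z μ) {F : ℕ → T → ℝ}
    (hF : ∀ j, Measurable (F j)) (hFi : ∀ j, Integrable (fun ω => F j (Z ω)) μ) :
    Integrable (fun ω => F (kHat ω) (Z ω)) μ ∧
      ∫ ω, F (kHat ω) (Z ω) ∂μ = ∑ j ∈ Finset.Icc 1 K, (K : ℝ)⁻¹ * ∫ ω, F j (Z ω) ∂μ := by
  have hmass : ∀ j ∈ Finset.Icc 1 K, μ.real (kHat ⁻¹' {j}) = (K : ℝ)⁻¹ := by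
    intro j hj
    rw [Measure.real, ← Measure.map_apply hk (measurableSet_singleton j), hunif,
      ← Finset.coe_Icc, ← Finset.coe_singleton, uniformOn_apply_finset,
      Finset.inter_singleton_of_mem hj]
    simp
  have hsupp : ∀ᵐ ω ∂μ, kHat ω ∈ Finset.Icc 1 K := by
    have h1 : ∀ᵐ k ∂(μ.map kHat), k ∈ Set.Icc 1 K := by
      rw [hunif, uniformOn]
      exact ae_cond_mem measurableSet_Icc
    filter_upwards [ae_of_ae_map hk.aemeasurable h1] with ω hω
    simpa using hω
  have hterm : ∀ j, Integrable (fun ω => (kHat ⁻¹' {j}).indicator (fun _ => (1 : ℝ)) ω * F j (Z ω)) μ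
      ∧ ∫ ω, (kHat ⁻¹' {j}).indicator (fun _ => (1 : ℝ)) ω * F j (Z ω) ∂μ
        = μ.real (kHat ⁻¹' {j}) * ∫ ω, F j (Z ω) ∂μ := by
    intro j
    have hms : MeasurableSet (kHat ⁻¹' {j}) := hk (measurableSet_singleton j)
    have hi : Integrable ((kHat ⁻¹' {j}).indicator (fun _ => (1 : ℝ))) μ :=
      (integrable_const 1).indicator hms
    have hii : IndepFun ((kHat ⁻¹' {j}).indicator (fun _ => (1 : ℝ))) (fun ω => F j (Z ω)) μ := by
      have := hind.comp (φ := ({j} : Set ℕ).indicator fun _ => (1 : ℝ)) (ψ := F j)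
        (Measurable.of_discrete) (hF j)
      exact this
    refine ⟨hii.integrable_mul hi (hFi j), ?_⟩
    have h2 := hii.integral_mul_eq_mul_integral hi.1 (hFi j).1
    rw [integral_indicator_const _ hms] at h2
    simpa using h2
  -- Split over the almost surely finitely many index values; each indicator is independent of `Z`,
  -- so every term factors.
  have hae : (fun ω => F (kHat ω) (Z ω)) =ᵐ[μ] fun ω => ∑ j ∈ Finset.Icc 1 K,
      (kHat ⁻¹' {j}).indicator (fun _ => (1 : ℝ)) ω * F j (Z ω) := by
    filter_upwards [hsupp] with ω hω
    rw [Finset.sum_eq_single_of_mem (kHat ω) hω]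
    · simp
    · intro j _ hj
      rw [Set.indicator_of_notMem (by simpa using hj.symm), zero_mul]
  refine ⟨(integrable_finsetSum _ fun j _ => (hterm j).1).congr hae.symm, ?_⟩
  rw [integral_congr_ae hae, integral_finsetSum _ fun j _ => (hterm j).1]
  refine Finset.sum_congr rfl fun j hj => ?_
  rw [(hterm j).2, hmass j hj]

end UniformIndex

/-! ### Pathwise and moment estimates along the run. -/

namespace LinConsProblem

open scoped RealInnerProductSpace

variable {Ξ : Type*} [MeasurableSpace Ξ] {d n : ℕ}

section Pathwise

/-- The search direction `(x_k - x_{k-1}) / η_k`, with the convention that it vanishes for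
`k = 0`. -/
noncomputable def runDir (p : LinConsProblem Ξ d n) (ρ : ℝ) (η α : ℕ → ℝ)
    (x₀ : EuclideanSpace ℝ (Fin d)) (lam₀ : EuclideanSpace ℝ (Fin n))
    (g₀ : EuclideanSpace ℝ (Fin d)) (y : ℕ → Ξ) : ℕ → EuclideanSpace ℝ (Fin d)
  | 0 => 0
  | k + 1 => -((p.run ρ η α x₀ lam₀ g₀ y k).g + p.At (p.run ρ η α x₀ lam₀ g₀ y k).lam
      + ρ • p.At (p.A (p.run ρ η α x₀ lam₀ g₀ y k).x - p.b))

/-- The increment `g_k - g_{k-1}` of the gradient estimator, where `g_{-1} = -Aᵀ λ₀` by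
convention. -/
noncomputable def runIncr (p : LinConsProblem Ξ d n) (ρ : ℝ) (η α : ℕ → ℝ)
    (x₀ : EuclideanSpace ℝ (Fin d)) (lam₀ : EuclideanSpace ℝ (Fin n))
    (g₀ : EuclideanSpace ℝ (Fin d)) (y : ℕ → Ξ) : ℕ → EuclideanSpace ℝ (Fin d)
  | 0 => g₀ + p.At lam₀
  | k + 1 => (p.run ρ η α x₀ lam₀ g₀ y (k + 1)).g - (p.run ρ η α x₀ lam₀ g₀ y k).g

variable {p : LinConsProblem Ξ d n} {L V fLow ρ : ℝ} {η α : ℕ → ℝ}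
  {x₀ : EuclideanSpace ℝ (Fin d)} {lam₀ : EuclideanSpace ℝ (Fin n)}
  {g₀ : EuclideanSpace ℝ (Fin d)}

theorem run_succ_x (y : ℕ → Ξ) (k : ℕ) : (p.run ρ η α x₀ lam₀ g₀ y (k + 1)).x
    = (p.run ρ η α x₀ lam₀ g₀ y k).x + η (k + 1) • p.runDir ρ η α x₀ lam₀ g₀ y (k + 1) := by
  rw [runDir, smul_neg, ← sub_eq_add_neg]; rfl

theorem run_succ_lam (y : ℕ → Ξ) (k : ℕ) : (p.run ρ η α x₀ lam₀ g₀ y (k + 1)).lam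
    = (p.run ρ η α x₀ lam₀ g₀ y k).lam
      + ρ • (p.A (p.run ρ η α x₀ lam₀ g₀ y (k + 1)).x - p.b) := rfl

theorem run_succ_residual (y : ℕ → Ξ) (k : ℕ) :
    p.A (p.run ρ η α x₀ lam₀ g₀ y (k + 1)).x - p.b = (p.A (p.run ρ η α x₀ lam₀ g₀ y k).x - p.b)
      + η (k + 1) • p.A (p.runDir ρ η α x₀ lam₀ g₀ y (k + 1)) := by
  rw [run_succ_x, map_add, map_smul]; abel

/-- The update direction uses λ_k + ρr_k, which differs from λ_{k+1} = λ_k + ρr_{k+1} by ρ times A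
of the displacement. This is the optimality condition in terms of the new multiplier. -/
theorem At_run_succ_lam (y : ℕ → Ξ) (k : ℕ) :
    p.At (p.run ρ η α x₀ lam₀ g₀ y (k + 1)).lam
      = ρ • p.At (p.A (η (k + 1) • p.runDir ρ η α x₀ lam₀ g₀ y (k + 1)))
        - p.runDir ρ η α x₀ lam₀ g₀ y (k + 1) - (p.run ρ η α x₀ lam₀ g₀ y k).g := by
  rw [run_succ_lam, run_succ_residual]
  have : p.At (p.run ρ η α x₀ lam₀ g₀ y k).lam = -p.runDir ρ η α x₀ lam₀ g₀ y (k + 1)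
      - (p.run ρ η α x₀ lam₀ g₀ y k).g
      - ρ • p.At (p.A (p.run ρ η α x₀ lam₀ g₀ y k).x - p.b) := by
    rw [runDir]; abel
  simp only [map_add, map_smul, smul_add, this]
  abel

/-- Difference of consecutive optimality conditions. -/
theorem optimality_difference (y : ℕ → Ξ) (k : ℕ) :
    ρ • p.At (p.A (p.run ρ η α x₀ lam₀ g₀ y (k + 1)).x - p.b) + p.runIncr ρ η α x₀ lam₀ g₀ y k
      + (p.runDir ρ η α x₀ lam₀ g₀ y (k + 1) - p.runDir ρ η α x₀ lam₀ g₀ y k)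
      - ρ • p.At (p.A (η (k + 1) • p.runDir ρ η α x₀ lam₀ g₀ y (k + 1)
        - η k • p.runDir ρ η α x₀ lam₀ g₀ y k)) = 0 := by
  have h1 := At_run_succ_lam (p := p) (ρ := ρ) (η := η) (α := α) (x₀ := x₀) (lam₀ := lam₀)
    (g₀ := g₀) y k
  have h2 : ρ • p.At (p.A (p.run ρ η α x₀ lam₀ g₀ y (k + 1)).x - p.b)
      = p.At (p.run ρ η α x₀ lam₀ g₀ y (k + 1)).lam - p.At (p.run ρ η α x₀ lam₀ g₀ y k).lam := by
    rw [run_succ_lam, map_add, map_smul]; abel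
  have h3 : p.At (p.run ρ η α x₀ lam₀ g₀ y k).lam
      = ρ • p.At (p.A (η k • p.runDir ρ η α x₀ lam₀ g₀ y k)) - p.runDir ρ η α x₀ lam₀ g₀ y k
        - ((p.run ρ η α x₀ lam₀ g₀ y k).g - p.runIncr ρ η α x₀ lam₀ g₀ y k) := by
    -- The conventions G₀ = 0 and g_{-1} = -Aᵀλ₀ are chosen so that the identity also holds at index
    -- 0.
    cases k with
    | zero => simp [runDir, runIncr, run]
    | succ k => rw [At_run_succ_lam, runIncr]; abel
  rw [h2, h1, h3, map_sub, map_sub, smul_sub]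
  abel

theorem inner_At (y : EuclideanSpace ℝ (Fin n)) (x : EuclideanSpace ℝ (Fin d)) :
    ⟪p.At y, x⟫ = ⟪y, p.A x⟫ := ContinuousLinearMap.adjoint_inner_left _ _ _

theorem norm_At_le : ‖p.At‖ ≤ ‖p.A‖ :=
  (LinearIsometryEquiv.norm_map ContinuousLinearMap.adjoint p.A).le

/-- Consistency puts the residual in the range of A, where the spectral bound holds. -/
theorem Assumptions.mul_sq_norm_residual_le (hp : p.Assumptions L V fLow) {δ : ℝ}
    (hδ : p.IsSmallestNonzeroEigenvalue δ) (x : EuclideanSpace ℝ (Fin d)) :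
    δ * ‖p.A x - p.b‖ ^ 2 ≤ ‖p.At (p.A x - p.b)‖ ^ 2 := by
  obtain ⟨z, hz⟩ := hp.feasible
  rw [← hz, ← map_sub]
  exact mul_sq_norm_le_sq_norm_adjoint p.A (fun t ht hev => hδ.2 ⟨ht, hev⟩) (x - z)

/-- Pathwise decrease along the iterates. -/
theorem Assumptions.run_augLagrangian_energy_step_le (hp : p.Assumptions L V fLow) {δ : ℝ}
    (hL : 0 < L) (hδ : p.IsSmallestNonzeroEigenvalue δ) (hρ : 0 ≤ ρ) (hρδ : 3000 * L ≤ ρ * δ)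
    (y : ℕ → Ξ) (k : ℕ) (hs : StepPair L (L + ρ * ‖p.A‖ ^ 2) (η k) (η (k + 1)))
    {s s' : State d n} (hks : s = p.run ρ η α x₀ lam₀ g₀ y k)
    (hks' : s' = p.run ρ η α x₀ lam₀ g₀ y (k + 1)) {γ G G' : EuclideanSpace ℝ (Fin d)}
    (hγ : γ = p.runIncr ρ η α x₀ lam₀ g₀ y k) (hG : G = p.runDir ρ η α x₀ lam₀ g₀ y k)
    (hG' : G' = p.runDir ρ η α x₀ lam₀ g₀ y (k + 1)) :
    p.f s'.x + ⟪s'.lam, p.A s'.x - p.b⟫ + ρ / 2 * ‖p.A s'.x - p.b‖ ^ 2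
        + 1 / (100 * L) * (ρ / (2 * η (k + 1)) * ‖p.A s'.x - p.b‖ ^ 2 + 1 / 2 * ‖G'‖ ^ 2)
        + ρ * ‖p.A s'.x - p.b‖ ^ 2
      ≤ p.f s.x + ⟪s.lam, p.A s.x - p.b⟫ + ρ / 2 * ‖p.A s.x - p.b‖ ^ 2
        + 1 / (100 * L) * (ρ / (2 * η k) * ‖p.A s.x - p.b‖ ^ 2 + 1 / 2 * ‖G‖ ^ 2)
        + ρ / 8 * ‖p.A s.x - p.b‖ ^ 2
        + η (k + 1) * ‖s.g - gradient p.f s.x‖ ^ 2 - 1 / 2 * η (k + 1) * ‖G'‖ ^ 2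
        + 1 / 100 * η k * ‖G‖ ^ 2 + 3 * (1 / (100 * L)) ^ 2 / η k * ‖γ‖ ^ 2 := by
  have hlam : s'.lam = s.lam + ρ • (p.A s'.x - p.b) := by
    rw [hks', hks, run_succ_lam]
  have hx : s'.x = s.x + η (k + 1) • G' := by rw [hks', hks, hG', run_succ_x]
  rw [hlam]
  refine augLagrangian_energy_step_le p.A p.At inner_At norm_At_le hL hρ hρδ hs
    (v := gradient p.f s.x) (e := s.g - gradient p.f s.x) ?_ ?_ ?_
    (hp.mul_sq_norm_residual_le hδ _) ?_
  · rw [hx]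
    exact le_add_inner_gradient_add_sq hp.differentiable_f (hp.norm_gradient_sub_le hL) _ _
  · rw [hG', hks, runDir, add_sub_cancel]
  · rw [hks', hks, hG', run_succ_residual]
  · rw [hks', hγ, hG, hG']
    exact optimality_difference y k

/-- Stationarity residual in terms of the search direction and the estimator error. -/
theorem sq_norm_stationarity_le (hL : 0 < L) (hp : p.Assumptions L V fLow) (hρ : 0 ≤ ρ)
    (y : ℕ → Ξ) (k : ℕ) (hη : 0 < η (k + 1)) (hM : (L + ρ * ‖p.A‖ ^ 2) * η (k + 1) ≤ 1) :
    ‖gradient p.f (p.run ρ η α x₀ lam₀ g₀ y (k + 1)).x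
        + p.At (p.run ρ η α x₀ lam₀ g₀ y (k + 1)).lam‖ ^ 2
      ≤ 8 * ‖p.runDir ρ η α x₀ lam₀ g₀ y (k + 1)‖ ^ 2
        + 8 * ‖(p.run ρ η α x₀ lam₀ g₀ y k).g - gradient p.f (p.run ρ η α x₀ lam₀ g₀ y k).x‖ ^ 2 := by
  rw [At_run_succ_lam]
  set G := p.runDir ρ η α x₀ lam₀ g₀ y (k + 1)
  set g := (p.run ρ η α x₀ lam₀ g₀ y k).g
  set x := (p.run ρ η α x₀ lam₀ g₀ y k).x with hx
  have hx' : (p.run ρ η α x₀ lam₀ g₀ y (k + 1)).x = x + η (k + 1) • G := run_succ_x y k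
  rw [hx']
  have h1 : ‖gradient p.f (x + η (k + 1) • G) - gradient p.f x‖ ≤ L * η (k + 1) * ‖G‖ := by
    refine (hp.norm_gradient_sub_le hL _ _).trans (le_of_eq ?_)
    rw [add_sub_cancel_left, norm_smul, Real.norm_of_nonneg hη.le, mul_assoc]
  have h2 : ‖ρ • p.At (p.A (η (k + 1) • G))‖ ≤ ρ * ‖p.A‖ ^ 2 * η (k + 1) * ‖G‖ := by
    rw [norm_smul, Real.norm_of_nonneg hρ]
    calc ρ * ‖p.At (p.A (η (k + 1) • G))‖ ≤ ρ * (‖p.A‖ * (‖p.A‖ * (η (k + 1) * ‖G‖))) := by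
          gcongr
          refine (p.At.le_opNorm _).trans ?_
          gcongr
          · exact norm_At_le
          · refine (p.A.le_opNorm _).trans (le_of_eq ?_)
            rw [norm_smul, Real.norm_of_nonneg hη.le]
      _ = _ := by ring
  -- The first two terms together are at most ‖G‖ by `hM`, whence 2‖G‖ + ‖e‖.
  have h3 : gradient p.f (x + η (k + 1) • G) + (ρ • p.At (p.A (η (k + 1) • G)) - G - g)
      = (gradient p.f (x + η (k + 1) • G) - gradient p.f x) + ρ • p.At (p.A (η (k + 1) • G))
        - G - (g - gradient p.f x) := by abel
  have h4 : ‖gradient p.f (x + η (k + 1) • G) + (ρ • p.At (p.A (η (k + 1) • G)) - G - g)‖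
      ≤ 2 * ‖G‖ + ‖g - gradient p.f x‖ := by
    rw [h3]
    have a1 := norm_sub_le ((gradient p.f (x + η (k + 1) • G) - gradient p.f x)
      + ρ • p.At (p.A (η (k + 1) • G)) - G) (g - gradient p.f x)
    have a2 := norm_sub_le ((gradient p.f (x + η (k + 1) • G) - gradient p.f x)
      + ρ • p.At (p.A (η (k + 1) • G))) G
    have a3 := norm_add_le (gradient p.f (x + η (k + 1) • G) - gradient p.f x)
      (ρ • p.At (p.A (η (k + 1) • G)))
    have a4 := mul_le_mul_of_nonneg_right hM (norm_nonneg G)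
    linarith only [a1, a2, a3, a4, h1, h2]
  have h5 : (2 * ‖G‖ + ‖g - gradient p.f x‖) ^ 2
      ≤ 2 * ((2 * ‖G‖) ^ 2 + ‖g - gradient p.f x‖ ^ 2) := add_sq_le
  have h6 := pow_le_pow_left₀ (norm_nonneg _) h4 2
  linarith only [h5, h6, sq_nonneg ‖g - gradient p.f x‖]

end Pathwise

section Moments

variable {p : LinConsProblem Ξ d n} {L V fLow ρ : ℝ} {η α : ℕ → ℝ}
  {x₀ : EuclideanSpace ℝ (Fin d)} {lam₀ : EuclideanSpace ℝ (Fin n)}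
  {g₀ : EuclideanSpace ℝ (Fin d)} {Ω : Type*} [MeasurableSpace Ω] {μ : Measure Ω}
  [IsProbabilityMeasure μ] {ξ : ℕ → Ω → Ξ}

theorem Assumptions.memLp_gradient_comp (hp : p.Assumptions L V fLow) (hL : 0 < L)
    {X : Ω → EuclideanSpace ℝ (Fin d)} (hX : MemLp X 2 μ) :
    MemLp (fun ω => gradient p.f (X ω)) 2 μ := by
  have hb : MemLp (fun ω => ‖gradient p.f 0‖ + L * ‖X ω‖) 2 μ :=
    MemLp.add (memLp_const ‖gradient p.f 0‖) (hX.norm.const_mul L)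
  refine hb.mono' ((hp.continuous_gradient hL).comp_aestronglyMeasurable hX.1)
    (Filter.Eventually.of_forall fun ω => ?_)
  have h1 := hp.norm_gradient_sub_le hL (X ω) 0
  have h2 := norm_add_le (gradient p.f (X ω) - gradient p.f 0) (gradient p.f 0)
  rw [sub_add_cancel] at h2
  rw [sub_zero] at h1
  linarith

/-- f lies between a constant and, by the descent lemma at 0, a quadratic. -/
theorem Assumptions.integrable_f_comp (hp : p.Assumptions L V fLow) (hL : 0 < L)
    {X : Ω → EuclideanSpace ℝ (Fin d)} (hX : MemLp X 2 μ) :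
    Integrable (fun ω => p.f (X ω)) μ := by
  have hsq := (memLp_two_iff_integrable_sq_norm hX.1).1 hX
  have hn : Integrable (fun ω => ‖X ω‖) μ := (hX.integrable (by norm_num)).norm
  have hb : Integrable (fun ω => (|fLow| + |p.f 0|) + (‖gradient p.f 0‖ * ‖X ω‖
      + L / 2 * ‖X ω‖ ^ 2)) μ :=
    (integrable_const _).add ((hn.const_mul _).add (hsq.const_mul _))
  refine hb.mono' (hp.differentiable_f.continuous.comp_aestronglyMeasurable hX.1)
    (Filter.Eventually.of_forall fun ω => ?_)
  have h1 := hp.bounded_below (X ω)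
  have h2 := le_add_inner_gradient_add_sq hp.differentiable_f (hp.norm_gradient_sub_le hL) 0 (X ω)
  rw [zero_add] at h2
  have h3 := real_inner_le_norm (gradient p.f 0) (X ω)
  have h4 : 0 ≤ ‖gradient p.f 0‖ * ‖X ω‖ := by positivity
  have h5 : 0 ≤ L / 2 * ‖X ω‖ ^ 2 := by positivity
  rw [Real.norm_eq_abs, abs_le]
  constructor
  · linarith [neg_abs_le fLow, abs_nonneg (p.f 0)]
  · linarith [le_abs_self (p.f 0), abs_nonneg fLow]

/-- One step of the stochastic recursion: given square-integrable iterates, the next estimator is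
square-integrable and its error and increment satisfy the recursive bounds. -/
theorem Assumptions.estimator_moments (hp : p.Assumptions L V fLow) (hL : 0 < L)
    (hξ : ∀ k, Measurable (ξ k)) (hξP : ∀ k, μ.map (ξ k) = p.P) (hind : iIndepFun ξ μ) (k : ℕ)
    (hx : MemLp (fun ω => (p.run ρ η α x₀ lam₀ g₀ (fun i => ξ i ω) k).x) 2 μ)
    (hx' : MemLp (fun ω => (p.run ρ η α x₀ lam₀ g₀ (fun i => ξ i ω) (k + 1)).x) 2 μ)
    (hg : MemLp (fun ω => (p.run ρ η α x₀ lam₀ g₀ (fun i => ξ i ω) k).g) 2 μ) :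
    MemLp (fun ω => (p.run ρ η α x₀ lam₀ g₀ (fun i => ξ i ω) (k + 1)).g) 2 μ ∧
    ∫ ω, ‖(p.run ρ η α x₀ lam₀ g₀ (fun i => ξ i ω) (k + 1)).g
        - gradient p.f (p.run ρ η α x₀ lam₀ g₀ (fun i => ξ i ω) (k + 1)).x‖ ^ 2 ∂μ
      ≤ (1 - α (k + 1)) ^ 2 * ∫ ω, ‖(p.run ρ η α x₀ lam₀ g₀ (fun i => ξ i ω) k).g
          - gradient p.f (p.run ρ η α x₀ lam₀ g₀ (fun i => ξ i ω) k).x‖ ^ 2 ∂μ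
        + 2 * (1 - α (k + 1)) ^ 2 * L ^ 2 * (η (k + 1) ^ 2 *
          ∫ ω, ‖p.runDir ρ η α x₀ lam₀ g₀ (fun i => ξ i ω) (k + 1)‖ ^ 2 ∂μ)
        + 2 * α (k + 1) ^ 2 * V ^ 2 ∧
    ∫ ω, ‖p.runIncr ρ η α x₀ lam₀ g₀ (fun i => ξ i ω) (k + 1)‖ ^ 2 ∂μ
      ≤ 4 * α (k + 1) ^ 2 * ∫ ω, ‖(p.run ρ η α x₀ lam₀ g₀ (fun i => ξ i ω) k).g
          - gradient p.f (p.run ρ η α x₀ lam₀ g₀ (fun i => ξ i ω) k).x‖ ^ 2 ∂μ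
        + 2 * L ^ 2 * (η (k + 1) ^ 2 *
          ∫ ω, ‖p.runDir ρ η α x₀ lam₀ g₀ (fun i => ξ i ω) (k + 1)‖ ^ 2 ∂μ)
        + 4 * α (k + 1) ^ 2 * V ^ 2 := by
  obtain ⟨mx, ml, mg⟩ := hp.measurable_run (ρ := ρ) (η := η) (α := α) (x₀ := x₀) (lam₀ := lam₀)
    (g₀ := g₀) k
  have hseq : Measurable fun ω i => ξ i ω := measurable_pi_lambda _ hξ
  have hS := (mx.comp hseq).prodMk ((ml.comp hseq).prodMk (mg.comp hseq))
  have hindep := hp.indepFun_run (ρ := ρ) (η := η) (α := α) (x₀ := x₀) (lam₀ := lam₀)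
    (g₀ := g₀) hξ hind k
  let E := EuclideanSpace ℝ (Fin d)
  let F := EuclideanSpace ℝ (Fin n)
  -- The next primal iterate is a function of the current state alone. Freezing the state therefore
  -- fixes both query points, and the frozen-state bounds apply.
  let nx : E × F × E → E := fun s =>
    s.1 - η (k + 1) • (s.2.2 + p.At s.2.1 + ρ • p.At (p.A s.1 - p.b))
  have hnx : Measurable nx := by fun_prop
  have hgr : Measurable (gradient p.f) := (hp.continuous_gradient hL).measurable
  let up : (E × F × E) × Ξ → E := fun z => p.oracle (nx z.1) z.2
    + (1 - α (k + 1)) • (z.1.2.2 - p.oracle z.1.1 z.2)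
  have hup : Measurable up := by
    have h1 : Measurable fun z : (E × F × E) × Ξ => p.oracle (nx z.1) z.2 :=
      hp.measurable_oracle.comp ((hnx.comp measurable_fst).prodMk measurable_snd)
    have h2 : Measurable fun z : (E × F × E) × Ξ => p.oracle z.1.1 z.2 :=
      hp.measurable_oracle.comp ((measurable_fst.comp measurable_fst).prodMk measurable_snd)
    have h3 : Measurable fun z : (E × F × E) × Ξ => z.1.2.2 := by fun_prop
    exact h1.add ((h3.sub h2).const_smul (1 - α (k + 1)))
  have hdir : ∀ ω, (p.run ρ η α x₀ lam₀ g₀ (fun i => ξ i ω) (k + 1)).x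
      - (p.run ρ η α x₀ lam₀ g₀ (fun i => ξ i ω) k).x
      = η (k + 1) • p.runDir ρ η α x₀ lam₀ g₀ (fun i => ξ i ω) (k + 1) := fun ω => by
    rw [run_succ_x, add_sub_cancel_left]
  have he := hg.sub (hp.memLp_gradient_comp hL hx)
  have hd := hx'.sub hx
  have ie : Integrable (fun ω => ‖(p.run ρ η α x₀ lam₀ g₀ (fun i => ξ i ω) k).g
      - gradient p.f (p.run ρ η α x₀ lam₀ g₀ (fun i => ξ i ω) k).x‖ ^ 2) μ :=
    (memLp_two_iff_integrable_sq_norm he.1).1 he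
  have id : Integrable (fun ω => ‖(p.run ρ η α x₀ lam₀ g₀ (fun i => ξ i ω) (k + 1)).x
      - (p.run ρ η α x₀ lam₀ g₀ (fun i => ξ i ω) k).x‖ ^ 2) μ :=
    (memLp_two_iff_integrable_sq_norm hd.1).1 hd
  have hdint : ∫ ω, ‖(p.run ρ η α x₀ lam₀ g₀ (fun i => ξ i ω) (k + 1)).x
      - (p.run ρ η α x₀ lam₀ g₀ (fun i => ξ i ω) k).x‖ ^ 2 ∂μ = η (k + 1) ^ 2 *
      ∫ ω, ‖p.runDir ρ η α x₀ lam₀ g₀ (fun i => ξ i ω) (k + 1)‖ ^ 2 ∂μ := by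
    rw [← integral_const_mul]
    refine integral_congr_ae (Filter.Eventually.of_forall fun ω => ?_)
    simp only [hdir, norm_smul, mul_pow, Real.norm_eq_abs, sq_abs]
  have hsplit : ∀ a b c : ℝ,
      Integrable (fun ω => a * ‖(p.run ρ η α x₀ lam₀ g₀ (fun i => ξ i ω) k).g
        - gradient p.f (p.run ρ η α x₀ lam₀ g₀ (fun i => ξ i ω) k).x‖ ^ 2
        + b * ‖(p.run ρ η α x₀ lam₀ g₀ (fun i => ξ i ω) (k + 1)).x
          - (p.run ρ η α x₀ lam₀ g₀ (fun i => ξ i ω) k).x‖ ^ 2 + c) μ ∧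
      ∫ ω, (a * ‖(p.run ρ η α x₀ lam₀ g₀ (fun i => ξ i ω) k).g
        - gradient p.f (p.run ρ η α x₀ lam₀ g₀ (fun i => ξ i ω) k).x‖ ^ 2
        + b * ‖(p.run ρ η α x₀ lam₀ g₀ (fun i => ξ i ω) (k + 1)).x
          - (p.run ρ η α x₀ lam₀ g₀ (fun i => ξ i ω) k).x‖ ^ 2 + c) ∂μ
      = a * ∫ ω, ‖(p.run ρ η α x₀ lam₀ g₀ (fun i => ξ i ω) k).g
          - gradient p.f (p.run ρ η α x₀ lam₀ g₀ (fun i => ξ i ω) k).x‖ ^ 2 ∂μ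
        + b * (η (k + 1) ^ 2 *
          ∫ ω, ‖p.runDir ρ η α x₀ lam₀ g₀ (fun i => ξ i ω) (k + 1)‖ ^ 2 ∂μ) + c := by
    intro a b c
    have i1 := (ie.const_mul a).add (id.const_mul b)
    refine ⟨i1.add (integrable_const c), ?_⟩
    rw [← hdint, ← integral_const_mul, ← integral_const_mul,
      ← integral_add (ie.const_mul a) (id.const_mul b)]
    refine (integral_add i1 (integrable_const c)).trans ?_
    simp
  have herr := sq_moment_le_of_indepFun hS (hξ k) hindep (hξP k)
    (H := fun z => up z - gradient p.f (nx z.1)) (hup.sub (hgr.comp (hnx.comp measurable_fst)))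
    (B := fun s => (1 - α (k + 1)) ^ 2 * ‖s.2.2 - gradient p.f s.1‖ ^ 2
        + 2 * (1 - α (k + 1)) ^ 2 * L ^ 2 * ‖nx s - s.1‖ ^ 2 + 2 * α (k + 1) ^ 2 * V ^ 2)
    (fun s => by positivity) (hsplit _ _ _).1
    (fun s => hp.lintegral_sq_error_le s.1 (nx s) s.2.2 (α (k + 1)))
  have hinc := sq_moment_le_of_indepFun hS (hξ k) hindep (hξP k)
    (H := fun z => up z - z.1.2.2) (hup.sub (by fun_prop))
    (B := fun s => 4 * α (k + 1) ^ 2 * ‖s.2.2 - gradient p.f s.1‖ ^ 2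
        + 2 * L ^ 2 * ‖nx s - s.1‖ ^ 2 + 4 * α (k + 1) ^ 2 * V ^ 2)
    (fun s => by positivity) (hsplit _ _ _).1
    (fun s => hp.lintegral_sq_increment_le s.1 (nx s) s.2.2 (α (k + 1)))
  refine ⟨?_, herr.2.trans (le_of_eq (hsplit _ _ _).2), hinc.2.trans (le_of_eq (hsplit _ _ _).2)⟩
  -- The increment is square-integrable by its moment bound; adding g_k gives the next estimator and
  -- closes the induction in `memLp_run`.
  have h1 := hinc.1.add hg
  refine h1.congr_norm ?_ (Filter.Eventually.of_forall fun ω => ?_)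
  · exact ((hp.measurable_run (k + 1)).2.2.comp hseq).aestronglyMeasurable
  · exact congrArg norm (sub_add_cancel _ _)

/-- All iterates are square-integrable. -/
theorem Assumptions.memLp_run (hp : p.Assumptions L V fLow) (hL : 0 < L)
    (hξ : ∀ k, Measurable (ξ k)) (hξP : ∀ k, μ.map (ξ k) = p.P) (hind : iIndepFun ξ μ) (k : ℕ) :
    MemLp (fun ω => (p.run ρ η α x₀ lam₀ g₀ (fun i => ξ i ω) k).x) 2 μ ∧
    MemLp (fun ω => (p.run ρ η α x₀ lam₀ g₀ (fun i => ξ i ω) k).lam) 2 μ ∧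
    MemLp (fun ω => (p.run ρ η α x₀ lam₀ g₀ (fun i => ξ i ω) k).g) 2 μ := by
  induction k with
  | zero => exact ⟨memLp_const _, memLp_const _, memLp_const _⟩
  | succ k ih =>
    obtain ⟨hx, hl, hg⟩ := ih
    have hx' : MemLp (fun ω => (p.run ρ η α x₀ lam₀ g₀ (fun i => ξ i ω) (k + 1)).x) 2 μ :=
      hx.sub (((hg.add (p.At.comp_memLp' hl)).add
        ((p.At.comp_memLp' ((p.A.comp_memLp' hx).sub (memLp_const p.b))).const_smul ρ)).const_smul
          (η (k + 1)))
    exact ⟨hx', hl.add (((p.A.comp_memLp' hx').sub (memLp_const p.b)).const_smul ρ),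
      (hp.estimator_moments hL hξ hξP hind k hx hx' hg).1⟩

end Moments

end LinConsProblem

/-! ### From weighted sums of second moments to expected norms. -/

section Averages

variable {Ω T : Type*} [MeasurableSpace Ω] [MeasurableSpace T]

theorem integral_linear_inequality {μ : Measure Ω} {l r g l₀ r₀ g₀ e i : Ω → ℝ}
    (hl : Integrable l μ) (hr : Integrable r μ) (hg : Integrable g μ) (hl₀ : Integrable l₀ μ)
    (hr₀ : Integrable r₀ μ) (hg₀ : Integrable g₀ μ) (he : Integrable e μ) (hi : Integrable i μ)
    (a₁ a₂ b₁ b₂ b₃ b₄ : ℝ)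
    (h : ∀ ω, l ω + a₁ * r ω + a₂ * g ω
      ≤ l₀ ω + b₁ * r₀ ω + b₂ * g₀ ω + b₃ * e ω + b₄ * i ω) :
    ∫ ω, l ω ∂μ + a₁ * ∫ ω, r ω ∂μ + a₂ * ∫ ω, g ω ∂μ
      ≤ ∫ ω, l₀ ω ∂μ + b₁ * ∫ ω, r₀ ω ∂μ + b₂ * ∫ ω, g₀ ω ∂μ + b₃ * ∫ ω, e ω ∂μ
        + b₄ * ∫ ω, i ω ∂μ := by
  have j1 : Integrable (fun ω => l ω + a₁ * r ω) μ := hl.add (hr.const_mul a₁)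
  have j2 : Integrable (fun ω => l ω + a₁ * r ω + a₂ * g ω) μ := j1.add (hg.const_mul a₂)
  have k1 : Integrable (fun ω => l₀ ω + b₁ * r₀ ω) μ := hl₀.add (hr₀.const_mul b₁)
  have k2 : Integrable (fun ω => l₀ ω + b₁ * r₀ ω + b₂ * g₀ ω) μ := k1.add (hg₀.const_mul b₂)
  have k3 : Integrable (fun ω => l₀ ω + b₁ * r₀ ω + b₂ * g₀ ω + b₃ * e ω) μ :=
    k2.add (he.const_mul b₃)
  have k4 : Integrable (fun ω => l₀ ω + b₁ * r₀ ω + b₂ * g₀ ω + b₃ * e ω + b₄ * i ω) μ :=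
    k3.add (hi.const_mul b₄)
  have := integral_mono j2 k4 h
  rwa [integral_add j1 (hg.const_mul a₂), integral_add hl (hr.const_mul a₁),
    integral_add k3 (hi.const_mul b₄), integral_add k2 (he.const_mul b₃),
    integral_add k1 (hg₀.const_mul b₂), integral_add hl₀ (hr₀.const_mul b₁), integral_const_mul,
    integral_const_mul, integral_const_mul, integral_const_mul, integral_const_mul,
    integral_const_mul] at this

/-- The shifted indices stay in {1, …, K + 1}, so one summed bound serves both output variants. -/
theorem sum_Icc_shift_le {v : ℕ → ℝ} (hv : ∀ j, 0 ≤ v j) {K s : ℕ} (hs : s ≤ 1) :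
    ∑ j ∈ Finset.Icc 1 K, v (j + s) ≤ ∑ k ∈ Finset.range (K + 1), v (k + 1) := by
  have h1 : ∑ j ∈ Finset.Icc 1 K, v (j + s)
      = ∑ i ∈ (Finset.Icc 1 K).image (fun j => j + s - 1), v (i + 1) := by
    rw [Finset.sum_image]
    · refine Finset.sum_congr rfl fun j hj => ?_
      rw [Finset.mem_Icc] at hj
      congr 1; omega
    · intro a ha b hb hab
      simp only [Finset.coe_Icc, Set.mem_Icc] at ha hb
      simp only at hab
      omega
  rw [h1]
  refine Finset.sum_le_sum_of_subset_of_nonneg (fun i hi => ?_) fun i _ _ => hv _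
  simp only [Finset.mem_image, Finset.mem_Icc] at hi
  obtain ⟨j, hj, rfl⟩ := hi
  rw [Finset.mem_range]; omega

/-- Expected norm at a uniformly drawn index, from a weighted sum of second moments. -/
theorem expected_norm_uniform_index_le {E : Type*} [NormedAddCommGroup E] [MeasurableSpace E]
    [BorelSpace E] {μ : Measure Ω} [IsProbabilityMeasure μ] {Z : Ω → T}
    {Y : ℕ → T → E} (hY : ∀ j, Measurable (Y j)) (hYL : ∀ j, MemLp (fun ω => Y j (Z ω)) 2 μ)
    {h : ℕ → ℝ} (hpos : ∀ k, 0 < h k) (hanti : Antitone h) {S ε : ℝ} (hε : 0 < ε)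
    (hS : ∀ T, ∑ k ∈ Finset.range T, h (k + 1) * ∫ ω, ‖Y (k + 1) (Z ω)‖ ^ 2 ∂μ ≤ S)
    {K : ℕ} (hK1 : 1 ≤ K) (hK : S ≤ ε ^ 2 * (K * h (K + 1)))
    {kHat : Ω → ℕ} (hk : Measurable kHat) (hunif : μ.map kHat = uniformOn (Set.Icc 1 K))
    (hind : IndepFun kHat Z μ) {s : ℕ} (hs : s ≤ 1) :
    Integrable (fun ω => ‖Y (kHat ω + s) (Z ω)‖) μ ∧
      ∫ ω, ‖Y (kHat ω + s) (Z ω)‖ ∂μ ≤ ε := by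
  obtain ⟨hint, heq⟩ := integral_uniform_index hk hunif hind
    (F := fun j z => ‖Y (j + s) z‖) (fun j => (hY _).norm)
    (fun j => ((hYL _).integrable (by norm_num)).norm)
  refine ⟨hint, ?_⟩
  rw [heq, ← Finset.mul_sum]
  set a : ℕ → ℝ := fun j => ∫ ω, ‖Y j (Z ω)‖ ∂μ
  set v : ℕ → ℝ := fun j => h j * ∫ ω, ‖Y j (Z ω)‖ ^ 2 ∂μ
  have hK0 : (0 : ℝ) < K := by exact_mod_cast hK1
  have hv : ∀ j, 0 ≤ v j := fun j => mul_nonneg (hpos j).le (integral_nonneg fun _ => sq_nonneg _)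
  have h1 : (∑ j ∈ Finset.Icc 1 K, a (j + s)) ^ 2 ≤ K * ∑ j ∈ Finset.Icc 1 K, a (j + s) ^ 2 := by
    simpa using sq_sum_le_card_mul_sum_sq (s := Finset.Icc 1 K) (f := fun j => a (j + s))
  -- Steps decrease and j + s ≤ K + 1, so the smallest weight h(K + 1) can be put on every term.
  have h2 : h (K + 1) * ∑ j ∈ Finset.Icc 1 K, a (j + s) ^ 2 ≤ S := by
    calc h (K + 1) * ∑ j ∈ Finset.Icc 1 K, a (j + s) ^ 2
        = ∑ j ∈ Finset.Icc 1 K, h (K + 1) * a (j + s) ^ 2 := Finset.mul_sum _ _ _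
      _ ≤ ∑ j ∈ Finset.Icc 1 K, v (j + s) := by
        refine Finset.sum_le_sum fun j hj => ?_
        rw [Finset.mem_Icc] at hj
        exact mul_le_mul (hanti (by omega)) (sq_integral_norm_le (hYL _)) (sq_nonneg _) (hpos _).le
      _ ≤ ∑ k ∈ Finset.range (K + 1), v (k + 1) := sum_Icc_shift_le hv hs
      _ ≤ S := hS (K + 1)
  refine le_of_pow_le_pow_left₀ two_ne_zero hε.le ?_
  have h3 : h (K + 1) * (∑ j ∈ Finset.Icc 1 K, a (j + s)) ^ 2
      ≤ h (K + 1) * (K ^ 2 * ε ^ 2) := by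
    calc h (K + 1) * (∑ j ∈ Finset.Icc 1 K, a (j + s)) ^ 2
        ≤ h (K + 1) * (K * ∑ j ∈ Finset.Icc 1 K, a (j + s) ^ 2) :=
          mul_le_mul_of_nonneg_left h1 (hpos _).le
      _ = K * (h (K + 1) * ∑ j ∈ Finset.Icc 1 K, a (j + s) ^ 2) := by ring
      _ ≤ K * (ε ^ 2 * (K * h (K + 1))) := mul_le_mul_of_nonneg_left (h2.trans hK) hK0.le
      _ = _ := by ring
  have h4 := le_of_mul_le_mul_left h3 (hpos (K + 1))
  rw [mul_pow, inv_pow, inv_mul_le_iff₀ (by positivity)]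
  exact h4

end Averages

/-! ### Summability in expectation along the run. -/

namespace LinConsProblem

open scoped RealInnerProductSpace

variable {Ξ : Type*} [MeasurableSpace Ξ] {d n : ℕ} {p : LinConsProblem Ξ d n}
  {L V fLow ρ δ : ℝ} {η α : ℕ → ℝ}
  {x₀ : EuclideanSpace ℝ (Fin d)} {lam₀ : EuclideanSpace ℝ (Fin n)}
  {g₀ : EuclideanSpace ℝ (Fin d)} {Ω : Type*} [MeasurableSpace Ω] {μ : Measure Ω}
  [IsProbabilityMeasure μ] {ξ : ℕ → Ω → Ξ}

theorem Assumptions.memLp_runDir (hp : p.Assumptions L V fLow) (hL : 0 < L)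
    (hξ : ∀ k, Measurable (ξ k)) (hξP : ∀ k, μ.map (ξ k) = p.P) (hind : iIndepFun ξ μ) (k : ℕ) :
    MemLp (fun ω => p.runDir ρ η α x₀ lam₀ g₀ (fun i => ξ i ω) k) 2 μ := by
  cases k with
  | zero => exact memLp_const 0
  | succ k =>
    obtain ⟨hx, hl, hg⟩ := hp.memLp_run (ρ := ρ) (η := η) (α := α) (x₀ := x₀) (lam₀ := lam₀)
      (g₀ := g₀) hL hξ hξP hind k
    exact ((hg.add (p.At.comp_memLp' hl)).add
      ((p.At.comp_memLp' ((p.A.comp_memLp' hx).sub (memLp_const p.b))).const_smul ρ)).neg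

theorem Assumptions.memLp_runIncr (hp : p.Assumptions L V fLow) (hL : 0 < L)
    (hξ : ∀ k, Measurable (ξ k)) (hξP : ∀ k, μ.map (ξ k) = p.P) (hind : iIndepFun ξ μ) (k : ℕ) :
    MemLp (fun ω => p.runIncr ρ η α x₀ lam₀ g₀ (fun i => ξ i ω) k) 2 μ := by
  cases k with
  | zero => exact memLp_const (g₀ + p.At lam₀)
  | succ k =>
    exact (hp.memLp_run hL hξ hξP hind (k + 1)).2.2.sub (hp.memLp_run hL hξ hξP hind k).2.2

/-- Lower bound for the augmented Lagrangian after a dual step. -/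
theorem Assumptions.dual_increment_le (hp : p.Assumptions L V fLow) (hρ : 0 < ρ)
    (y : ℕ → Ξ) (k : ℕ) {s s' : State d n} (hks : s = p.run ρ η α x₀ lam₀ g₀ y k)
    (hks' : s' = p.run ρ η α x₀ lam₀ g₀ y (k + 1)) :
    fLow + (1 / (2 * ρ)) * ‖s'.lam‖ ^ 2 ≤ p.f s'.x + ⟪s'.lam, p.A s'.x - p.b⟫
      + ρ / 2 * ‖p.A s'.x - p.b‖ ^ 2 + (1 / (2 * ρ)) * ‖s.lam‖ ^ 2 := by
  have hlam : s.lam = s'.lam - ρ • (p.A s'.x - p.b) := by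
    rw [hks', hks, run_succ_lam, add_sub_cancel_right]
  -- Expanding the square of the dual update expresses the indefinite term ⟪λ', r'⟫ by an increment
  -- of ‖λ‖²/(2ρ) plus a nonnegative term.
  have h1 : ‖s.lam‖ ^ 2 = ‖s'.lam‖ ^ 2 - 2 * ρ * ⟪s'.lam, p.A s'.x - p.b⟫
      + ρ ^ 2 * ‖p.A s'.x - p.b‖ ^ 2 := by
    rw [hlam, norm_sub_sq_real, inner_smul_right, norm_smul, mul_pow, Real.norm_eq_abs, sq_abs]
    ring
  have h2 : (1 / (2 * ρ)) * ‖s.lam‖ ^ 2 = (1 / (2 * ρ)) * ‖s'.lam‖ ^ 2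
      - ⟪s'.lam, p.A s'.x - p.b⟫ + ρ / 2 * ‖p.A s'.x - p.b‖ ^ 2 := by
    rw [h1]; field_simp
  have h3 := hp.bounded_below s'.x
  have h4 : 0 ≤ ρ / 2 * ‖p.A s'.x - p.b‖ ^ 2 := by positivity
  linarith only [h2, h3, h4]

/-- Summability, in expectation, of the quantities that control stationarity. -/
theorem Assumptions.run_expected_sum_le (hp : p.Assumptions L V fLow) (hL : 0 < L)
    (hδ : p.IsSmallestNonzeroEigenvalue δ) (hρ : 0 < ρ) (hρδ : 3000 * L ≤ ρ * δ)
    (hs : ∀ k, StepPair L (L + ρ * ‖p.A‖ ^ 2) (η k) (η (k + 1)))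
    (hα : ∀ k, α k = 121 * L ^ 2 * η k ^ 2)
    (hξ : ∀ k, Measurable (ξ k)) (hξP : ∀ k, μ.map (ξ k) = p.P) (hind : iIndepFun ξ μ)
    {S₀ S₃ : ℝ} (hsum : ∀ T, ∑ k ∈ Finset.range T, η (k + 1) ^ 3 ≤ S₃)
    (hinit : p.f x₀ + ⟪lam₀, p.A x₀ - p.b⟫ + ρ / 2 * ‖p.A x₀ - p.b‖ ^ 2 - fLow
      + 1 / (100 * L) * (ρ / (2 * η 0) * ‖p.A x₀ - p.b‖ ^ 2) + ρ / 4 * ‖p.A x₀ - p.b‖ ^ 2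
      + 2 / (121 * L ^ 2) / η 0 * ‖g₀ - gradient p.f x₀‖ ^ 2
      + 3 * (1 / (100 * L)) ^ 2 / η 0 * ‖g₀ + p.At lam₀‖ ^ 2 ≤ S₀) (T : ℕ) :
    ∑ k ∈ Finset.range T,
      (η (k + 1) * ∫ ω, ‖p.runDir ρ η α x₀ lam₀ g₀ (fun i => ξ i ω) (k + 1)‖ ^ 2 ∂μ
        + η (k + 1) * ∫ ω, ‖(p.run ρ η α x₀ lam₀ g₀ (fun i => ξ i ω) k).g
          - gradient p.f (p.run ρ η α x₀ lam₀ g₀ (fun i => ξ i ω) k).x‖ ^ 2 ∂μ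
        + ρ * ∫ ω, ‖p.A (p.run ρ η α x₀ lam₀ g₀ (fun i => ξ i ω) (k + 1)).x - p.b‖ ^ 2 ∂μ)
      ≤ 4 * (S₀ + 600 * L ^ 2 * V ^ 2 * S₃) := by
  have hm := fun k => hp.memLp_run (ρ := ρ) (η := η) (α := α) (x₀ := x₀) (lam₀ := lam₀)
    (g₀ := g₀) hL hξ hξP hind k
  have sq {E : Type} [NormedAddCommGroup E] {Y : Ω → E} (hY : MemLp Y 2 μ) :
      Integrable (fun ω => ‖Y ω‖ ^ 2) μ := (memLp_two_iff_integrable_sq_norm hY.1).1 hY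
  have hr : ∀ k, MemLp (fun ω => p.A (p.run ρ η α x₀ lam₀ g₀ (fun i => ξ i ω) k).x - p.b) 2 μ :=
    fun k => (p.A.comp_memLp' (hm k).1).sub (memLp_const p.b)
  have he : ∀ k, MemLp (fun ω => (p.run ρ η α x₀ lam₀ g₀ (fun i => ξ i ω) k).g
      - gradient p.f (p.run ρ η α x₀ lam₀ g₀ (fun i => ξ i ω) k).x) 2 μ :=
    fun k => (hm k).2.2.sub (hp.memLp_gradient_comp hL (hm k).1)
  have hG := fun k => hp.memLp_runDir (ρ := ρ) (η := η) (α := α) (x₀ := x₀) (lam₀ := lam₀)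
    (g₀ := g₀) hL hξ hξP hind k
  have hi := fun k => hp.memLp_runIncr (ρ := ρ) (η := η) (α := α) (x₀ := x₀) (lam₀ := lam₀)
    (g₀ := g₀) hL hξ hξP hind k
  have hlagi : ∀ k, Integrable (fun ω => p.f (p.run ρ η α x₀ lam₀ g₀ (fun i => ξ i ω) k).x
      + ⟪(p.run ρ η α x₀ lam₀ g₀ (fun i => ξ i ω) k).lam,
        p.A (p.run ρ η α x₀ lam₀ g₀ (fun i => ξ i ω) k).x - p.b⟫
      + ρ / 2 * ‖p.A (p.run ρ η α x₀ lam₀ g₀ (fun i => ξ i ω) k).x - p.b‖ ^ 2) μ :=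
    fun k => ((hp.integrable_f_comp hL (hm k).1).add
      (integrable_inner_of_memLp_two (hm k).2.1 (hr k))).add ((sq (hr k)).const_mul _)
  refine expected_sum_le (M := L + ρ * ‖p.A‖ ^ 2) (fLow := fLow) (h := η) (α := α)
    (EL := fun k => ∫ ω, (p.f (p.run ρ η α x₀ lam₀ g₀ (fun i => ξ i ω) k).x
      + ⟪(p.run ρ η α x₀ lam₀ g₀ (fun i => ξ i ω) k).lam,
        p.A (p.run ρ η α x₀ lam₀ g₀ (fun i => ξ i ω) k).x - p.b⟫
      + ρ / 2 * ‖p.A (p.run ρ η α x₀ lam₀ g₀ (fun i => ξ i ω) k).x - p.b‖ ^ 2) ∂μ)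
    (ER := fun k => ∫ ω, ‖p.A (p.run ρ η α x₀ lam₀ g₀ (fun i => ξ i ω) k).x - p.b‖ ^ 2 ∂μ)
    (EG := fun k => ∫ ω, ‖p.runDir ρ η α x₀ lam₀ g₀ (fun i => ξ i ω) k‖ ^ 2 ∂μ)
    (Ee := fun k => ∫ ω, ‖(p.run ρ η α x₀ lam₀ g₀ (fun i => ξ i ω) k).g
      - gradient p.f (p.run ρ η α x₀ lam₀ g₀ (fun i => ξ i ω) k).x‖ ^ 2 ∂μ)
    (Ei := fun k => ∫ ω, ‖p.runIncr ρ η α x₀ lam₀ g₀ (fun i => ξ i ω) k‖ ^ 2 ∂μ)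
    (El := fun k => ∫ ω, ‖(p.run ρ η α x₀ lam₀ g₀ (fun i => ξ i ω) k).lam‖ ^ 2 ∂μ)
    hL hρ (by have : 0 ≤ ρ * ‖p.A‖ ^ 2 := by positivity
              linarith) hs hα
    (fun k => integral_nonneg fun _ => sq_nonneg _) (fun k => integral_nonneg fun _ => sq_nonneg _)
    (fun k => integral_nonneg fun _ => sq_nonneg _) (fun k => integral_nonneg fun _ => sq_nonneg _)
    (fun k => integral_nonneg fun _ => sq_nonneg _) ?_
    (fun k => (hp.estimator_moments hL hξ hξP hind k (hm k).1 (hm (k + 1)).1 (hm k).2.2).2.1)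
    (fun k => (hp.estimator_moments hL hξ hξP hind k (hm k).1 (hm (k + 1)).1 (hm k).2.2).2.2)
    ?_ ?_ hsum T
  · intro k
    have key := integral_linear_inequality (hlagi (k + 1)) (sq (hr (k + 1))) (sq (hG (k + 1)))
      (hlagi k) (sq (hr k)) (sq (hG k)) (sq (he k)) (sq (hi k))
      (1 / (100 * L) * (ρ / (2 * η (k + 1))) + ρ) (1 / (100 * L) * (1 / 2) + 1 / 2 * η (k + 1))
      (1 / (100 * L) * (ρ / (2 * η k)) + ρ / 8) (1 / (100 * L) * (1 / 2) + 1 / 100 * η k)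
      (η (k + 1)) (3 * (1 / (100 * L)) ^ 2 / η k) (fun ω => by
        have := hp.run_augLagrangian_energy_step_le (α := α) (x₀ := x₀) (lam₀ := lam₀) (g₀ := g₀)
          hL hδ hρ.le hρδ (fun i => ξ i ω) k (hs k) rfl rfl rfl rfl rfl
        linarith only [this])
    linarith only [key]
  · intro k
    have i1 := (sq (hm (k + 1)).2.1).const_mul (1 / (2 * ρ))
    have i0 := (sq (hm k).2.1).const_mul (1 / (2 * ρ))
    have key := integral_mono ((integrable_const fLow).add i1) ((hlagi (k + 1)).add i0)
      (fun ω => hp.dual_increment_le (η := η) (α := α) (x₀ := x₀) (lam₀ := lam₀) (g₀ := g₀) hρ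
        (fun i => ξ i ω) k rfl rfl)
    rw [integral_add' (integrable_const fLow) i1, integral_add' (hlagi (k + 1)) i0,
      integral_const_mul, integral_const_mul] at key
    simp only [integral_const, probReal_univ, smul_eq_mul, one_mul] at key
    rw [sub_div, div_eq_inv_mul, div_eq_inv_mul, ← one_div]
    linarith only [key]
  · simp only [run, runDir, runIncr, integral_const, probReal_univ, smul_eq_mul, one_mul,
      norm_zero]
    linarith only [hinit]

end LinConsProblem

/-! ### Consequences of the prescribed parameters. -/

section Parameters

theorem weightM_pos {c₂ c₃ L : ℝ} (hL : 0 < L) (hc₂ : 0 < c₂) (hc₃ : 0 < c₃) :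
    0 < weightM c₂ c₃ L := by
  rw [weightM]
  refine lt_min (by positivity) (lt_min (by positivity) (by positivity))

/-- The first entry of the maximum gives ρδ ≥ 7(1 + c₁)/m with m ≤ 1/(448L), and 7·448 = 3136. -/
theorem le_penaltyRho_mul {c₁ c₂ c₃ c₄ L δ : ℝ} (hL : 0 < L) (hc₁ : 0 < c₁) (hc₂ : 0 < c₂)
    (hc₃ : 0 < c₃) (hδ : 0 < δ) : 3000 * L ≤ penaltyRho c₁ c₂ c₃ c₄ L δ * δ := by
  have hm := weightM_pos hL hc₂ hc₃
  have h1 : 7 * (1 + c₁) / (weightM c₂ c₃ L * δ) ≤ penaltyRho c₁ c₂ c₃ c₄ L δ := le_max_left _ _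
  have h2 : weightM c₂ c₃ L ≤ 1 / (448 * L) := min_le_left _ _
  have h3 : weightM c₂ c₃ L * (448 * L) ≤ 1 := (le_div_iff₀ (by positivity)).1 h2
  refine le_trans ?_ (mul_le_mul_of_nonneg_right h1 hδ.le)
  have h4 : 7 * (1 + c₁) / (weightM c₂ c₃ L * δ) * δ = 7 * (1 + c₁) / weightM c₂ c₃ L := by
    field_simp
  rw [h4, le_div_iff₀ hm]
  linarith

/-- From δ ≤ ‖A‖² follows ρ‖A‖² ≥ 3000L, so 1/(Lη) = 11(L + ρ‖A‖²)/L ≥ 33000. -/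
theorem stepSize_parameters {L ρ δ a η : ℝ} (hL : 0 < L) (hρ : 0 < ρ) (hρδ : 3000 * L ≤ ρ * δ)
    (hδa : δ ≤ a ^ 2) (hη : η = baseStep L ρ a) :
    0 < η ∧ L + ρ * a ^ 2 = 1 / (11 * η) ∧ 30000 ≤ 1 / (L * η) := by
  have hM : 0 < L + ρ * a ^ 2 := by positivity
  have hη0 : 0 < η := by rw [hη, baseStep]; positivity
  have h1 : L + ρ * a ^ 2 = 1 / (11 * η) := by rw [hη, baseStep]; field_simp
  refine ⟨hη0, h1, ?_⟩
  have h2 : 1 / (L * η) = 11 * (L + ρ * a ^ 2) / L := by rw [h1]; field_simp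
  rw [h2, le_div_iff₀ hL]
  have := mul_le_mul_of_nonneg_left hδa hρ.le
  linarith

end Parameters

/-! ### Initial potential, output guarantee and assembly. -/

namespace LinConsProblem

open scoped RealInnerProductSpace

variable {Ξ : Type*} [MeasurableSpace Ξ] {d n : ℕ} {p : LinConsProblem Ξ d n}
  {L V fLow ρ δ : ℝ}

/-- Initial value of the potential, from a common bound `R` on the initial data. -/
theorem Assumptions.initial_potential_le (hp : p.Assumptions L V fLow) (hL : 0 < L) (hρ : 0 < ρ)
    {h R : ℝ} (hh : 0 < h) {x₀ : EuclideanSpace ℝ (Fin d)} {lam₀ : EuclideanSpace ℝ (Fin n)}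
    {g₀ : EuclideanSpace ℝ (Fin d)} (hf : p.f x₀ - fLow ≤ R) (hlam : ‖lam₀‖ ≤ R)
    (hg : ‖g₀ - gradient p.f x₀‖ ≤ R) (hr : ‖p.A x₀ - p.b‖ ≤ R) :
    p.f x₀ + ⟪lam₀, p.A x₀ - p.b⟫ + ρ / 2 * ‖p.A x₀ - p.b‖ ^ 2 - fLow
      + 1 / (100 * L) * (ρ / (2 * h) * ‖p.A x₀ - p.b‖ ^ 2) + ρ / 4 * ‖p.A x₀ - p.b‖ ^ 2
      + 2 / (121 * L ^ 2) / h * ‖g₀ - gradient p.f x₀‖ ^ 2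
      + 3 * (1 / (100 * L)) ^ 2 / h * ‖g₀ + p.At lam₀‖ ^ 2
    ≤ R + R ^ 2 + ρ / 2 * R ^ 2 + 1 / (100 * L) * (ρ / (2 * h) * R ^ 2) + ρ / 4 * R ^ 2
      + 2 / (121 * L ^ 2) / h * R ^ 2
      + 3 * (1 / (100 * L)) ^ 2 / h * (3 * (R ^ 2 + 2 * L * R + ‖p.A‖ ^ 2 * R ^ 2)) := by
  have hin : ⟪lam₀, p.A x₀ - p.b⟫ ≤ R ^ 2 := by
    refine (real_inner_le_norm _ _).trans ?_
    rw [sq]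
    exact mul_le_mul hlam hr (norm_nonneg _) ((norm_nonneg _).trans hlam)
  have hr2 : ‖p.A x₀ - p.b‖ ^ 2 ≤ R ^ 2 := pow_le_pow_left₀ (norm_nonneg _) hr 2
  have hg2 : ‖g₀ - gradient p.f x₀‖ ^ 2 ≤ R ^ 2 := pow_le_pow_left₀ (norm_nonneg _) hg 2
  have hgrad : ‖gradient p.f x₀‖ ^ 2 ≤ 2 * L * R :=
    (sq_norm_gradient_le hL hp.differentiable_f (hp.norm_gradient_sub_le hL)
      hp.bounded_below x₀).trans (by gcongr)
  have hAt : ‖p.At lam₀‖ ^ 2 ≤ ‖p.A‖ ^ 2 * R ^ 2 := by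
    rw [← mul_pow]
    refine pow_le_pow_left₀ (norm_nonneg _) ((p.At.le_opNorm _).trans ?_) 2
    exact mul_le_mul norm_At_le hlam (norm_nonneg _) (norm_nonneg _)
  have hinc : ‖g₀ + p.At lam₀‖ ^ 2 ≤ 3 * (R ^ 2 + 2 * L * R + ‖p.A‖ ^ 2 * R ^ 2) := by
    have h1 : ‖g₀ + p.At lam₀‖ ≤ ‖g₀ - gradient p.f x₀‖ + ‖gradient p.f x₀‖ + ‖p.At lam₀‖ := by
      have e : g₀ + p.At lam₀ = (g₀ - gradient p.f x₀) + gradient p.f x₀ + p.At lam₀ := by abel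
      rw [e]; exact norm_add₃_le
    have h2 := pow_le_pow_left₀ (norm_nonneg _) h1 2
    linarith only [h2, hg2, hgrad, hAt, sq_nonneg (‖g₀ - gradient p.f x₀‖ - ‖gradient p.f x₀‖),
      sq_nonneg (‖g₀ - gradient p.f x₀‖ - ‖p.At lam₀‖),
      sq_nonneg (‖gradient p.f x₀‖ - ‖p.At lam₀‖)]
  have t1 : ρ / 2 * ‖p.A x₀ - p.b‖ ^ 2 ≤ ρ / 2 * R ^ 2 := by gcongr
  have t2 : 1 / (100 * L) * (ρ / (2 * h) * ‖p.A x₀ - p.b‖ ^ 2)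
      ≤ 1 / (100 * L) * (ρ / (2 * h) * R ^ 2) := by gcongr
  have t3 : ρ / 4 * ‖p.A x₀ - p.b‖ ^ 2 ≤ ρ / 4 * R ^ 2 := by gcongr
  have t4 := mul_le_mul_of_nonneg_left hg2 (by positivity : 0 ≤ 2 / (121 * L ^ 2) / h)
  have t5 := mul_le_mul_of_nonneg_left hinc (by positivity : 0 ≤ 3 * (1 / (100 * L)) ^ 2 / h)
  linarith only [hf, hin, t1, t2, t3, t4, t5]

/-- Both stationarity measures at a uniformly drawn index are small. -/
theorem Assumptions.output_stationary (hp : p.Assumptions L V fLow) (hL : 0 < L)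
    (hδ : p.IsSmallestNonzeroEigenvalue δ) (hρ : 0 < ρ) (hρδ : 3000 * L ≤ ρ * δ)
    {η α : ℕ → ℝ} {b : ℝ} (hb : ∀ k, η k ≤ b)
    (hs : ∀ k, StepPair L (L + ρ * ‖p.A‖ ^ 2) (η k) (η (k + 1)))
    (hα : ∀ k, α k = 121 * L ^ 2 * η k ^ 2)
    {x₀ : EuclideanSpace ℝ (Fin d)} {lam₀ : EuclideanSpace ℝ (Fin n)}
    {g₀ : EuclideanSpace ℝ (Fin d)} {Ω : Type*} [MeasurableSpace Ω] {μ : Measure Ω}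
    [IsProbabilityMeasure μ] {ξ : ℕ → Ω → Ξ}
    (hξ : ∀ k, Measurable (ξ k)) (hξP : ∀ k, μ.map (ξ k) = p.P) (hind : iIndepFun ξ μ)
    {S₀ S₃ : ℝ} (hsum : ∀ T, ∑ k ∈ Finset.range T, η (k + 1) ^ 3 ≤ S₃)
    (hinit : p.f x₀ + ⟪lam₀, p.A x₀ - p.b⟫ + ρ / 2 * ‖p.A x₀ - p.b‖ ^ 2 - fLow
      + 1 / (100 * L) * (ρ / (2 * η 0) * ‖p.A x₀ - p.b‖ ^ 2) + ρ / 4 * ‖p.A x₀ - p.b‖ ^ 2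
      + 2 / (121 * L ^ 2) / η 0 * ‖g₀ - gradient p.f x₀‖ ^ 2
      + 3 * (1 / (100 * L)) ^ 2 / η 0 * ‖g₀ + p.At lam₀‖ ^ 2 ≤ S₀)
    {ε : ℝ} (hε : 0 < ε) {K : ℕ} (hK1 : 1 ≤ K)
    (hK : (8 + b / ρ) * (4 * (S₀ + 600 * L ^ 2 * V ^ 2 * S₃)) ≤ ε ^ 2 * (K * η (K + 1)))
    {kHat : Ω → ℕ} (hk : Measurable kHat) (hunif : μ.map kHat = uniformOn (Set.Icc 1 K))
    (hki : IndepFun kHat (fun ω k => ξ k ω) μ) {s : ℕ} (hs1 : s ≤ 1) {out : Ω → State d n}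
    (hout : ∀ ω, out ω = p.run ρ η α x₀ lam₀ g₀ (fun k => ξ k ω) (kHat ω + s)) :
    Integrable (fun ω => ‖gradient p.f (out ω).x + p.At (out ω).lam‖) μ ∧
      ∫ ω, ‖gradient p.f (out ω).x + p.At (out ω).lam‖ ∂μ ≤ ε ∧
      Integrable (fun ω => ‖p.A (out ω).x - p.b‖) μ ∧
      ∫ ω, ‖p.A (out ω).x - p.b‖ ∂μ ≤ ε := by
  simp only [hout]
  have hpos : ∀ k, 0 < η k := fun k => (hs k).pos.trans_le (hs k).le
  have hanti : Antitone η := antitone_nat_of_succ_le fun k => (hs k).le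
  have hb0 : 0 ≤ b := (hpos 0).le.trans (hb 0)
  have hmeas := fun k => hp.measurable_run (ρ := ρ) (η := η) (α := α) (x₀ := x₀) (lam₀ := lam₀)
    (g₀ := g₀) k
  have hm := fun k => hp.memLp_run (ρ := ρ) (η := η) (α := α) (x₀ := x₀) (lam₀ := lam₀)
    (g₀ := g₀) hL hξ hξP hind k
  have htot := hp.run_expected_sum_le hL hδ hρ hρδ hs hα hξ hξP hind hsum hinit
  have sq {E : Type} [NormedAddCommGroup E] {Y : Ω → E} (hY : MemLp Y 2 μ) :
      Integrable (fun ω => ‖Y ω‖ ^ 2) μ := (memLp_two_iff_integrable_sq_norm hY.1).1 hY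
  have hstat : ∀ k, MemLp (fun ω => gradient p.f (p.run ρ η α x₀ lam₀ g₀ (fun i => ξ i ω) k).x
      + p.At (p.run ρ η α x₀ lam₀ g₀ (fun i => ξ i ω) k).lam) 2 μ :=
    fun k => (hp.memLp_gradient_comp hL (hm k).1).add (p.At.comp_memLp' (hm k).2.1)
  have hres : ∀ k, MemLp (fun ω => p.A (p.run ρ η α x₀ lam₀ g₀ (fun i => ξ i ω) k).x - p.b) 2 μ :=
    fun k => (p.A.comp_memLp' (hm k).1).sub (memLp_const p.b)
  have hgr : Measurable (gradient p.f) := (hp.continuous_gradient hL).measurable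
  have hweight : 0 ≤ b / ρ := by positivity
  -- The factor 8 comes from the stationarity residual; b/ρ converts ρE‖r‖² into η E‖r‖², since η ≤
  -- b.
  have hscale : ∀ (T : ℕ) (v : ℕ → ℝ), (∀ k, v k ≤ (8 + b / ρ) *
      (η (k + 1) * ∫ ω, ‖p.runDir ρ η α x₀ lam₀ g₀ (fun i => ξ i ω) (k + 1)‖ ^ 2 ∂μ
        + η (k + 1) * ∫ ω, ‖(p.run ρ η α x₀ lam₀ g₀ (fun i => ξ i ω) k).g
          - gradient p.f (p.run ρ η α x₀ lam₀ g₀ (fun i => ξ i ω) k).x‖ ^ 2 ∂μ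
        + ρ * ∫ ω, ‖p.A (p.run ρ η α x₀ lam₀ g₀ (fun i => ξ i ω) (k + 1)).x - p.b‖ ^ 2 ∂μ)) →
      ∑ k ∈ Finset.range T, v k ≤ (8 + b / ρ) * (4 * (S₀ + 600 * L ^ 2 * V ^ 2 * S₃)) := by
    intro T v hv
    refine (Finset.sum_le_sum fun k _ => hv k).trans ?_
    rw [← Finset.mul_sum]
    exact mul_le_mul_of_nonneg_left (htot T) (by positivity)
  have hI1 : ∀ k, 0 ≤ η (k + 1) *
      ∫ ω, ‖p.runDir ρ η α x₀ lam₀ g₀ (fun i => ξ i ω) (k + 1)‖ ^ 2 ∂μ := fun k =>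
    mul_nonneg (hpos _).le (integral_nonneg fun _ => sq_nonneg _)
  have hI2 : ∀ k, 0 ≤ η (k + 1) * ∫ ω, ‖(p.run ρ η α x₀ lam₀ g₀ (fun i => ξ i ω) k).g
      - gradient p.f (p.run ρ η α x₀ lam₀ g₀ (fun i => ξ i ω) k).x‖ ^ 2 ∂μ := fun k =>
    mul_nonneg (hpos _).le (integral_nonneg fun _ => sq_nonneg _)
  have hI3 : ∀ k, 0 ≤ ∫ ω, ‖p.A (p.run ρ η α x₀ lam₀ g₀ (fun i => ξ i ω) (k + 1)).x - p.b‖ ^ 2 ∂μ :=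
    fun k => integral_nonneg fun _ => sq_nonneg _
  have hfirst := expected_norm_uniform_index_le (μ := μ) (Z := fun ω k => ξ k ω)
    (Y := fun k y => gradient p.f (p.run ρ η α x₀ lam₀ g₀ y k).x
      + p.At (p.run ρ η α x₀ lam₀ g₀ y k).lam)
    (fun k => (hgr.comp (hmeas k).1).add (p.At.measurable.comp (hmeas k).2.1)) hstat hpos hanti hε
    (fun T => hscale T _ fun k => ?_) hK1 hK hk hunif hki hs1
  · have hsecond := expected_norm_uniform_index_le (μ := μ) (Z := fun ω k => ξ k ω)
      (Y := fun k y => p.A (p.run ρ η α x₀ lam₀ g₀ y k).x - p.b)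
      (fun k => (p.A.measurable.comp (hmeas k).1).sub_const p.b) hres hpos hanti hε
      (fun T => hscale T _ fun k => ?_) hK1 hK hk hunif hki hs1
    · exact ⟨hfirst.1, hfirst.2, hsecond.1, hsecond.2⟩
    · have h1 := mul_le_mul_of_nonneg_right (hb (k + 1)) (hI3 k)
      have h2 : b / ρ * (ρ * ∫ ω, ‖p.A (p.run ρ η α x₀ lam₀ g₀ (fun i => ξ i ω) (k + 1)).x
          - p.b‖ ^ 2 ∂μ) = b * ∫ ω, ‖p.A (p.run ρ η α x₀ lam₀ g₀ (fun i => ξ i ω) (k + 1)).x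
          - p.b‖ ^ 2 ∂μ := by field_simp
      have h3 := mul_nonneg (by positivity : 0 ≤ 8 + b / ρ) (hI1 k)
      have h4 := mul_nonneg (by positivity : 0 ≤ 8 + b / ρ) (hI2 k)
      have h5 := mul_nonneg hρ.le (hI3 k)
      linarith only [h1, h2, h3, h4, h5]
  · have hi1 := sq (hp.memLp_runDir (ρ := ρ) (η := η) (α := α) (x₀ := x₀) (lam₀ := lam₀)
      (g₀ := g₀) hL hξ hξP hind (k + 1))
    have hi2 := sq ((hm k).2.2.sub (hp.memLp_gradient_comp hL (hm k).1))
    have h1 := integral_mono (sq (hstat (k + 1))) ((hi1.const_mul 8).add (hi2.const_mul 8))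
      (fun ω => sq_norm_stationarity_le hL hp hρ.le (fun i => ξ i ω) k (hpos (k + 1))
        (((mul_le_mul_of_nonneg_left (hs k).le (by positivity)).trans (hs k).mul_le).trans
          (by norm_num)))
    rw [integral_add' (hi1.const_mul 8) (hi2.const_mul 8), integral_const_mul,
      integral_const_mul] at h1
    have h2 := mul_le_mul_of_nonneg_left h1 (hpos (k + 1)).le
    have h3 := mul_nonneg hweight (hI1 k)
    have h4 := mul_nonneg hweight (hI2 k)
    have h5 := mul_nonneg (by positivity : 0 ≤ (8 + b / ρ) * ρ) (hI3 k)
    simp only [Pi.sub_apply] at h2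
    linarith only [h2, h3, h4, h5]

end LinConsProblem

theorem mainTheorem1
    (Lf V δ normA c₁ c₂ c₃ c₄ k₀ ρ η R : ℝ)
    (hLf : 0 < Lf) (hc₁ : 0 < c₁) (hc₂ : 0 < c₂) (hc₃ : 0 < c₃) (hc₄ : 0 < c₄)
    (hρ : ρ = penaltyRho c₁ c₂ c₃ c₄ Lf δ)
    (hη : η = baseStep Lf ρ normA)
    (hk₀ : shiftLowerBound c₁ c₂ c₄ Lf (weightM c₂ c₃ Lf) η ≤ k₀) :
    ∃ (C : ℝ) (q : ℕ), 0 < C ∧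
      -- every problem with these constants, in every dimension, and every initialization
      ∀ {Ξ : Type*} [MeasurableSpace Ξ] {d n : ℕ} (p : LinConsProblem Ξ d n) (fLow : ℝ),
      p.Assumptions Lf V fLow → p.IsSmallestNonzeroEigenvalue δ → ‖p.A‖ = normA →
      ∀ (x₀ : EuclideanSpace ℝ (Fin d)) (lam₀ : EuclideanSpace ℝ (Fin n))
        (g₀ : EuclideanSpace ℝ (Fin d)),
      p.f x₀ - fLow ≤ R → ‖lam₀‖ ≤ R → ‖g₀ - gradient p.f x₀‖ ≤ R → ‖p.A x₀ - p.b‖ ≤ R →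
      -- i.i.d. samples with law `P`
      ∀ {Ω : Type*} [MeasurableSpace Ω] (μ : Measure Ω) [IsProbabilityMeasure μ]
        (ξ : ℕ → Ω → Ξ),
      (∀ k, Measurable (ξ k)) → (∀ k, μ.map (ξ k) = p.P) → iIndepFun ξ μ →
      ∀ ε : ℝ, 0 < ε → ε ≤ 1 →
      ∃ N : ℕ, 1 ≤ N ∧ (N : ℝ) ≤ C * ε⁻¹ ^ 3 * (1 + Real.log ε⁻¹) ^ q ∧
        -- number of stochastic gradient evaluations
        (∀ ω, ((p.run ρ (stepSize η k₀) (momentum Lf η k₀) x₀ lam₀ g₀ (fun k => ξ k ω)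
          (N + 1)).calls : ℝ) ≤ C * ε⁻¹ ^ 3 * (1 + Real.log ε⁻¹) ^ q) ∧
        -- the output index is uniform on `{1, …, K}` and independent of the samples; the output is
        -- the pair with index `kHat` or, in the shifted variant, with index `kHat + 1`
        ∀ K : ℕ, N ≤ K → ∀ kHat : Ω → ℕ, Measurable kHat →
          μ.map kHat = uniformOn (Set.Icc 1 K) →
          IndepFun kHat (fun ω k => ξ k ω) μ →
          ∀ s : ℕ, s ≤ 1 →
          ∀ out : Ω → LinConsProblem.State d n,
          (∀ ω, out ω = p.run ρ (stepSize η k₀) (momentum Lf η k₀) x₀ lam₀ g₀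
            (fun k => ξ k ω) (kHat ω + s)) →
          Integrable (fun ω => ‖gradient p.f (out ω).x + p.At (out ω).lam‖) μ ∧
          ∫ ω, ‖gradient p.f (out ω).x + p.At (out ω).lam‖ ∂μ ≤ ε ∧
          Integrable (fun ω => ‖p.A (out ω).x - p.b‖) μ ∧
          ∫ ω, ‖p.A (out ω).x - p.b‖ ∂μ ≤ ε := by
  -- The constants are chosen before any problem is given. If δ fails these bounds, no problem has δ
  -- as its smallest nonzero eigenvalue and `normA` as its norm.
  by_cases hδ : 0 < δ ∧ δ ≤ normA ^ 2
  swap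
  · refine ⟨1, 0, one_pos, ?_⟩
    intro Ξ _ d n p fLow hp hδp hnA
    refine absurd ?_ hδ
    obtain ⟨h1, h2⟩ := eigenvalue_adjoint_comp_self_bounds p.A hδp.1.2
    exact ⟨lt_of_le_of_ne h1 hδp.1.1.symm, hnA ▸ h2⟩
  obtain ⟨hδ0, hδA⟩ := hδ
  have hρδ : 3000 * Lf ≤ ρ * δ := hρ ▸ le_penaltyRho_mul hLf hc₁ hc₂ hc₃ hδ0
  have hρ0 : 0 < ρ := pos_of_mul_pos_left (lt_of_lt_of_le (by positivity) hρδ) hδ0.le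
  obtain ⟨hη0, hM, hθ⟩ := stepSize_parameters hLf hρ0 hρδ hδA hη
  have hk₀2 : 2 ≤ k₀ := by
    refine le_trans ?_ hk₀
    simp [shiftLowerBound]
  have hk₀6 : (50 / (363 * (Lf * η) ^ 2)) ^ 6 ≤ k₀ := by
    refine le_trans ?_ hk₀
    have e : 363 * (Lf * η) ^ 2 = 3 * (121 * Lf ^ 2) * η ^ 2 := by ring
    rw [e]
    simp [shiftLowerBound]
  have hk₀3 : 3 ≤ k₀ :=
    (rpow_third_mul_log_bounds (by positivity) hθ (by linarith) hk₀6).1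
  have hpair : ∀ k, StepPair Lf (Lf + ρ * normA ^ 2) (stepSize η k₀ k) (stepSize η k₀ (k + 1)) :=
    fun k => hM ▸ stepSize_pair hLf hη0 hθ hk₀6 hk₀2 k
  have hanti : Antitone (stepSize η k₀) := antitone_nat_of_succ_le fun k => (hpair k).le
  have hh0 : 0 < stepSize η k₀ 0 := (hpair 0).pos.trans_le (hpair 0).le
  set h₀ := stepSize η k₀ 0 with hh₀
  set S₀ := R + R ^ 2 + ρ / 2 * R ^ 2 + 1 / (100 * Lf) * (ρ / (2 * h₀) * R ^ 2) + ρ / 4 * R ^ 2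
      + 2 / (121 * Lf ^ 2) / h₀ * R ^ 2
      + 3 * (1 / (100 * Lf)) ^ 2 / h₀ * (3 * (R ^ 2 + 2 * Lf * R + normA ^ 2 * R ^ 2)) with hS₀
  -- The absolute value is needed because nothing fixes the sign of R at this point.
  set S := |(8 + h₀ / ρ) * (4 * (S₀ + 600 * Lf ^ 2 * V ^ 2 * η ^ 3))|
  set σ := max 1 (9 * (S * (k₀ + 2) ^ 2 / η))
  have hσ : 1 ≤ σ := le_max_left _ _
  -- With N = ⌈(σU)³⌉ there are 2(N + 1) ≤ 2(σU)³ + 4 evaluations, and U ≥ 1 absorbs the 4. The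
  -- exponent 3 is that of the logarithm in U³.
  refine ⟨2 * (σ ^ 3 + 2), 3, by positivity, ?_⟩
  intro Ξ _ d n p fLow hp hδp hnA x₀ lam₀ g₀ hf hlam hg hr Ω _ μ _ ξ hξ hξP hind ε hε hε1
  have hinv : 1 ≤ ε⁻¹ := (one_le_inv₀ hε).2 hε1
  have hlog : 0 ≤ Real.log ε⁻¹ := Real.log_nonneg hinv
  set U := ε⁻¹ * (1 + Real.log ε⁻¹) with hU
  have hU1 : 1 ≤ U := one_le_mul_of_one_le_of_one_le hinv (by linarith)
  have hU3 : 1 ≤ U ^ 3 := one_le_pow₀ hU1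
  have hσU : 1 ≤ (σ * U) ^ 3 := one_le_pow₀ (one_le_mul_of_one_le_of_one_le hσ hU1)
  have hbound : 2 * (σ ^ 3 + 2) * ε⁻¹ ^ 3 * (1 + Real.log ε⁻¹) ^ 3
      = 2 * (σ * U) ^ 3 + 4 * U ^ 3 := by rw [hU]; ring
  have hN := (Nat.ceil_lt_add_one (by positivity : 0 ≤ (σ * U) ^ 3)).le
  have hN1 : 1 ≤ ⌈(σ * U) ^ 3⌉₊ := Nat.one_le_ceil_iff.2 (by linarith)
  refine ⟨⌈(σ * U) ^ 3⌉₊, hN1, ?_, ?_, ?_⟩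
  · rw [hbound]; linarith
  · intro ω
    rw [LinConsProblem.calls_run, hbound]
    push_cast
    linarith
  · intro K hK kHat hkm hku hki s hs out hout
    have hKU : (σ * U) ^ 3 ≤ K := (Nat.le_ceil _).trans (by exact_mod_cast hK)
    have hrate := le_sq_mul_stepSize (abs_nonneg _) hη0 hk₀2 hε hε1 hKU
    have hinit := hp.initial_potential_le hLf hρ0 hh0 hf hlam hg hr
    rw [hnA, ← hS₀] at hinit
    exact hp.output_stationary hLf hδp hρ0 hρδ (fun k => hanti (Nat.zero_le k))
      (by rw [hnA]; exact hpair) (fun k => rfl) hξ hξP hind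
      (sum_stepSize_pow_three_le hη0 hk₀3) hinit hε (hN1.trans hK)
      ((le_abs_self _).trans hrate) hkm hku hki hs hout
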